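/- Let $\mathcal O$ be a discrete valuation ring with fraction field $F$, maximal ideal $\mathcal P=(\varpi)$ (for instance the ring of integers of a non-archimedean local field $F$), and let $V=W_1\oplus W_2$ be a finite-dimensional $F$-vector space, $n_i=\dim W_i$, $n=\min(n_1,n_2)$. Let $\mathcal B^0$ be the set of vertices of the Euclidean building of $\mathrm{GL}(V)$, i.e. of homothety classes $[\Lambda]$ of full $\mathcal O$-lattices $\Lambda\subset V$; two distinct vertices are joined by an edge of the $1$-skeleton if they have representatives with $\varpi\Lambda_1\subset\Lambda_2\subset\Lambda_1$. Let $L=\mathrm{GL}(W_1)\times\mathrm{GL}(W_2)\subset\mathrm{GL}(V)$. For a lattice $\Lambda$ let $Q_i(\Lambda)=p_i(\Lambda)/(\Lambda\cap W_i)$, with $p_i$ the projection to $W_i$ along the other summand. Then $Q_1(\Lambda)\cong Q_2(\Lambda)$ as $\mathcal O$-modules; write $Q(\Lambda)$ for either. Its annihilator is a power of $\mathcal P$, and its exponent, which depends only on $[\Lambda]$, is denoted $d_{\mathcal A}([\Lambda])=\log_{\mathcal P}\mathrm{Ann}(Q(\Lambda))$. Fix bases $(e_i)$ of $W_1$ and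 $(f_j)$ of $W_2$. Let $A^n$ be the set of $\alpha\in\mathbb N^n$ with $\alpha_1\ge\dots\ge\alpha_n$, and let $\Lambda^\alpha$ be the $\mathcal O$-span of all $e_i$, of $\varpi^{-\alpha_j}e_j+f_j$ for $j\le n$, and of $f_j$ for $j>n$. Then $\alpha\mapsto L[\Lambda^\alpha]$ is a bijection from $A^n$ to the set of $L$-orbits in $\mathcal B^0$. The orbital distance $d_O$ of the orbits that correspond to $\alpha$ and $\beta$ is $\max_i|\alpha_i-\beta_i|$ (and $0$ if $n=0$). A frame of a vector space is a set of linearly independent lines that spans it; the apartment $\mathcal A_{\mathcal F}$ of a frame $\mathcal F$ of $V$ has as vertices the classes of the lattices $\bigoplus_{l\in\mathcal F}\mathcal O e_l$ with $0\ne e_l\in l$. Let $\overline{\mathcal A_{\mathcal F_1\cup\mathcal F_2}}$ be the union of the apartments $\mathcal A_{\mathcal F_1\cup\mathcal F_2}$ over all frames $\mathcal F_1$ of $W_1$ and $\mathcal F_2$ of $W_2$. Theorem. The vertex set of $\overline{\mathcal A_{\mathcal F_1\cup\mathcal F_2}}$ is a single $L$-orbit, the one that corresponds to $(0,\dots,0)\in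 A^n$, and for every $[\Lambda]\in\mathcal B^0$ $$d_{\mathcal A}([\Lambda])=d_O\bigl(L[\Lambda],\overline{\mathcal A_{\mathcal F_1\cup\mathcal F_2}}\bigr).$$ If $L[\Lambda]=L[\Lambda^\alpha]$, this number is the largest $\alpha_i$ (and $0$ if $n=0$). It is also the minimal distance in the $1$-skeleton between a vertex of $L[\Lambda]$ and a vertex of $\overline{\mathcal A_{\mathcal F_1\cup\mathcal F_2}}$, and the minimal distance from $[\Lambda]$ to a vertex of $\overline{\mathcal A_{\mathcal F_1\cup\mathcal F_2}}$. In particular, if $n_1=n_2=1$, then $\overline{\mathcal A_{\mathcal F_1\cup\mathcal F_2}}$ is the apartment of the frame $\{W_1,W_2\}$, and $d_{\mathcal A}([\Lambda])$ is the distance from $[\Lambda]$ to this apartment. -/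

import Mathlib

open scoped Pointwise

namespace EuclideanBuilding

noncomputable section

section Building

variable (O F V : Type*) [CommRing O] [Field F] [Algebra O F] [AddCommGroup V] [Module F V]
  [Module O V] [IsScalarTower O F V]

/-- The `O`-lattices of full rank in `V`. -/
abbrev Lattice : Type _ := {Λ : Submodule O V // Submodule.IsLattice F Λ}

/-- Homothety of lattices: `Λ' = a Λ` for some `a ∈ Fˣ`. -/
def homothety : Setoid (Lattice O F V) where
  r Λ Λ' := ∃ a : Fˣ, Λ'.1 = a • Λ.1
  iseqv :=
    { refl := fun Λ => ⟨1, (one_smul _ _).symm⟩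
      symm := by
        rintro Λ Λ' ⟨a, h⟩
        exact ⟨a⁻¹, by rw [h, inv_smul_smul]⟩
      trans := by
        rintro Λ Λ' Λ'' ⟨a, h⟩ ⟨b, h'⟩
        exact ⟨b * a, by rw [h', h, mul_smul]⟩ }

/-- The vertices of the Euclidean building of `GL(V)`: homothety classes of lattices. -/
def Vertex : Type _ := Quotient (homothety O F V)

variable {O F V}

/-- The homothety class `[Λ]`. -/
def Vertex.mk (Λ : Lattice O F V) : Vertex O F V := Quotient.mk (homothety O F V) Λ

/-- Two vertices are incident if they have representatives with `ϖ Λ₁ ⊆ Λ₂ ⊆ Λ₁`. -/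
def Incident (ϖ : O) (x y : Vertex O F V) : Prop :=
  ∃ Λ₁ Λ₂ : Lattice O F V, Vertex.mk Λ₁ = x ∧ Vertex.mk Λ₂ = y ∧
    ϖ • Λ₁.1 ≤ Λ₂.1 ∧ Λ₂.1 ≤ Λ₁.1

variable (F V) in
/-- The `1`-skeleton of the building: distinct vertices are adjacent when they are incident. -/
def oneSkeleton (ϖ : O) : SimpleGraph (Vertex O F V) := SimpleGraph.fromRel (Incident ϖ)

/-- The image `g Λ` of a lattice under `g ∈ GL(V)`. -/
def Lattice.image (g : V ≃ₗ[F] V) (Λ : Lattice O F V) : Lattice O F V :=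
  ⟨Λ.1.map ((g : V →ₗ[F] V).restrictScalars O),
    { fg := (Λ.2.fg).map _
      span_eq_top := by
        rw [Submodule.map_coe, LinearMap.coe_restrictScalars, ← Submodule.map_span,
          Λ.2.span_eq_top, Submodule.map_top, LinearMap.range_eq_top]
        exact g.surjective }⟩

/-- The natural action of `GL(V)` on the vertices. -/
instance : MulAction (V ≃ₗ[F] V) (Vertex O F V) where
  smul g := Quotient.map (Lattice.image g) (by
    rintro Λ Λ' ⟨a, h⟩
    refine ⟨a, ?_⟩
    ext v
    simp only [Lattice.image, h, Submodule.mem_map]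
    constructor
    · rintro ⟨_, ⟨w, hw, rfl⟩, rfl⟩
      exact ⟨g w, ⟨w, hw, rfl⟩, by simp⟩
    · rintro ⟨_, ⟨w, hw, rfl⟩, rfl⟩
      exact ⟨a • w, ⟨w, hw, rfl⟩, by simp [Units.smul_def]⟩)
  one_smul := by
    rintro ⟨Λ⟩
    refine congrArg (Quotient.mk _) (Subtype.ext ?_)
    ext v
    simp [Lattice.image]
  mul_smul := by
    rintro g h ⟨Λ⟩
    refine congrArg (Quotient.mk _) (Subtype.ext ?_)
    ext v
    simp [Lattice.image]

/-- A frame in the subspace `W`: a collection of linearly independent lines which spans `W`. -/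
structure IsFrame (W : Submodule F V) (S : Set (Submodule F V)) : Prop where
  line : ∀ l ∈ S, Module.finrank F l = 1
  indep : sSupIndep S
  span : sSup S = W

variable (O) in
/-- The vertices of the apartment of a frame `S`: the classes of the lattices `⨁ O e_l`,
where `e_l` is a nonzero vector of the line `l ∈ S`. -/
def apartment (S : Set (Submodule F V)) : Set (Vertex O F V) :=
  {x | ∃ (Λ : Lattice O F V) (b : S → V), (∀ l, b l ∈ l.1 ∧ b l ≠ 0) ∧
    Λ.1 = Submodule.span O (Set.range b) ∧ Vertex.mk Λ = x}

variable (O) in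
/-- The union of the apartments of all frames `S₁ ∪ S₂`, `S₁` a frame in `W₁` and `S₂` a frame
in `W₂`. -/
def adaptedApartments (W₁ W₂ : Submodule F V) : Set (Vertex O F V) :=
  {x | ∃ S₁ S₂ : Set (Submodule F V), IsFrame W₁ S₁ ∧ IsFrame W₂ S₂ ∧ x ∈ apartment O (S₁ ∪ S₂)}

/-- The Levi subgroup `GL(W₁) × GL(W₂)` of `GL(V)`, for `V = W₁ ⊕ W₂`. -/
def levi (W₁ W₂ : Submodule F V) : Subgroup (V ≃ₗ[F] V) where
  carrier := {g | W₁.map (g : V →ₗ[F] V) = W₁ ∧ W₂.map (g : V →ₗ[F] V) = W₂}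
  one_mem' := ⟨Submodule.map_id _, Submodule.map_id _⟩
  mul_mem' := by
    rintro g h ⟨g₁, g₂⟩ ⟨h₁, h₂⟩
    have key : ((g * h : V ≃ₗ[F] V) : V →ₗ[F] V) = (g : V →ₗ[F] V) ∘ₗ (h : V →ₗ[F] V) := rfl
    exact ⟨by rw [key, Submodule.map_comp, h₁, g₁], by rw [key, Submodule.map_comp, h₂, g₂]⟩
  inv_mem' := by
    rintro g ⟨g₁, g₂⟩
    have key : ((g⁻¹ : V ≃ₗ[F] V) : V →ₗ[F] V) ∘ₗ (g : V →ₗ[F] V) = LinearMap.id := by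
      ext v
      exact g.symm_apply_apply v
    constructor
    · conv_lhs => rw [← g₁]
      rw [← Submodule.map_comp, key, Submodule.map_id]
    · conv_lhs => rw [← g₂]
      rw [← Submodule.map_comp, key, Submodule.map_id]

/-- The orbit of a vertex under the Levi subgroup `L = GL(W₁) × GL(W₂)`. -/
def leviOrbit (W₁ W₂ : Submodule F V) (x : Vertex O F V) : Set (Vertex O F V) :=
  MulAction.orbit (levi W₁ W₂) x

/-- For `V = W ⊕ W'`, the image of `Λ` under the projection to `W` along `W'`. -/
def projPart {W W' : Submodule F V} (h : IsCompl W W') (Λ : Lattice O F V) : Submodule O V :=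
  Λ.1.map ((W.projection W' h).restrictScalars O)

/-- The intersection of `Λ` with `W`. -/
def kerPart (W : Submodule F V) (Λ : Lattice O F V) : Submodule O V :=
  Λ.1 ⊓ W.restrictScalars O

/-- The `O`-module `Q(Λ)`: the projection of `Λ` to `W` modulo `Λ ∩ W`. -/
abbrev QMod {W W' : Submodule F V} (h : IsCompl W W') (Λ : Lattice O F V) : Type _ :=
  projPart h Λ ⧸ (kerPart W Λ).submoduleOf (projPart h Λ)

/-- The logarithm `log_P` of a power of the maximal ideal `P`: `log_P (P ^ k) = k`. -/
def logP [IsLocalRing O] (I : Ideal O) : ℕ := sInf {k : ℕ | I = IsLocalRing.maximalIdeal O ^ k}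

theorem mem_annihilator_QMod {W W' : Submodule F V} (h : IsCompl W W') (Λ : Lattice O F V)
    (r : O) : r ∈ Module.annihilator O (QMod h Λ) ↔
      ∀ v ∈ Λ.1, r • W.projection W' h v ∈ Λ.1 := by
  rw [Module.mem_annihilator]
  constructor
  · intro H v hv
    have := H (Submodule.Quotient.mk ⟨W.projection W' h v, v, hv, rfl⟩)
    rw [← Submodule.Quotient.mk_smul, Submodule.Quotient.mk_eq_zero] at this
    exact this.1
  · intro H q
    induction q using Submodule.Quotient.induction_on with
    | H x =>
      obtain ⟨x, v, hv, rfl⟩ := x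
      rw [← Submodule.Quotient.mk_smul, Submodule.Quotient.mk_eq_zero]
      refine ⟨H v hv, ?_⟩
      exact (W.restrictScalars O).smul_mem r (W.projectionOnto W' h v).2

/-- The function `d_A([Λ]) = log_P Ann(Q(Λ))` on the vertices of the building. -/
def annLog [IsLocalRing O] {W₁ W₂ : Submodule F V} (h : IsCompl W₁ W₂) : Vertex O F V → ℕ :=
  Quotient.lift (fun Λ => logP (Module.annihilator O (QMod h Λ))) (by
    rintro Λ Λ' ⟨a, ha⟩
    congr 1
    ext r
    simp only [mem_annihilator_QMod, ha]
    have key : ∀ v : V, r • W₁.projection W₂ h (a • v) = a • (r • W₁.projection W₂ h v) := by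
      intro v
      rw [Units.smul_def, map_smul, ← Units.smul_def, smul_comm]
    constructor
    · rintro H _ ⟨v, hv, rfl⟩
      exact (key v).symm ▸ Submodule.smul_mem_pointwise_smul _ a _ (H v hv)
    · intro H v hv
      have := H (a • v) (Submodule.smul_mem_pointwise_smul _ a _ hv)
      rw [key v] at this
      obtain ⟨w, hw, hwv⟩ := this
      exact (MulAction.injective a hwv) ▸ hw)

/-- The set `A^n` of weakly decreasing sequences of `n` natural numbers. -/
abbrev DecSeq (n : ℕ) : Type := {α : Fin n → ℕ // Antitone α}

/-- The zero sequence in `A^n`. -/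
def DecSeq.zero (n : ℕ) : DecSeq n := ⟨fun _ => 0, antitone_const⟩

instance (n : ℕ) : Nonempty (DecSeq n) := ⟨DecSeq.zero n⟩

/-- The distance `max_i |α_i - β_i|` on `A^n` (it is `0` for `n = 0`). -/
def DecSeq.dist {n : ℕ} (α β : DecSeq n) : ℕ :=
  Finset.univ.sup fun i => ((α.1 i : ℤ) - (β.1 i : ℤ)).natAbs

variable {n₁ n₂ : ℕ} {W₁ W₂ : Submodule F V}

/-- The vectors `ϖ ^ (-α_j) e_j + f_j` for `j < min n₁ n₂`, and `f_j` for the other `j`. -/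
def repVec (ϖ : O) (e : Module.Basis (Fin n₁) F W₁) (f : Module.Basis (Fin n₂) F W₂)
    (α : DecSeq (min n₁ n₂)) (j : Fin n₂) : V :=
  if hj : j.1 < n₁ then
    (algebraMap O F ϖ) ^ (-(α.1 ⟨j.1, lt_min hj j.2⟩ : ℤ)) • (e ⟨j.1, hj⟩ : V) + (f j : V)
  else (f j : V)

/-- The lattice `Λ^α`, spanned over `O` by all `e_i` and the vectors `ϖ ^ (-α_j) e_j + f_j`
(`f_j` if there is no `e_j`). For `n₁ ≤ n₂` it is the direct sum of the rank two lattices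
`⟨e_i, ϖ ^ (-α_i) e_i + f_i⟩` with `i ≤ n₁` and the rank one lattices `⟨f_j⟩` with `j > n₁`. -/
def repLattice (h : IsCompl W₁ W₂) (ϖ : O) (e : Module.Basis (Fin n₁) F W₁)
    (f : Module.Basis (Fin n₂) F W₂) (α : DecSeq (min n₁ n₂)) : Lattice O F V :=
  ⟨Submodule.span O (Set.range (fun i => (e i : V)) ∪ Set.range (repVec ϖ e f α)),
    { fg := Submodule.fg_span ((Set.finite_range _).union (Set.finite_range _))
      span_eq_top := by
        rw [Submodule.span_span_of_tower, eq_top_iff, ← h.sup_eq_top]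
        set T := Submodule.span F
          (Set.range (fun i => (e i : V)) ∪ Set.range (repVec ϖ e f α)) with hT
        have he : ∀ i, (e i : V) ∈ T := fun i => Submodule.subset_span (Or.inl ⟨i, rfl⟩)
        have hf : ∀ j, (f j : V) ∈ T := by
          intro j
          have hj : repVec ϖ e f α j ∈ T := Submodule.subset_span (Or.inr ⟨j, rfl⟩)
          unfold repVec at hj
          split_ifs at hj with hlt
          · exact (Submodule.add_mem_iff_right _ (T.smul_mem _ (he _))).1 hj
          · exact hj
        refine sup_le ?_ ?_
        · intro w hw
          have := congrArg (Subtype.val) (e.sum_repr ⟨w, hw⟩)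
          rw [← show _ = w from this]
          simp only [AddSubmonoidClass.coe_finsetSum, Submodule.coe_smul]
          exact T.sum_mem fun i _ => T.smul_mem _ (he i)
        · intro w hw
          have := congrArg (Subtype.val) (f.sum_repr ⟨w, hw⟩)
          rw [← show _ = w from this]
          simp only [AddSubmonoidClass.coe_finsetSum, Submodule.coe_smul]
          exact T.sum_mem fun i _ => T.smul_mem _ (hf i) }⟩

/-- The map from `A^n`, `n = min n₁ n₂`, to the `L`-orbits of vertices, `α ↦ L [Λ^α]`. -/
def repOrbit (h : IsCompl W₁ W₂) (ϖ : O) (e : Module.Basis (Fin n₁) F W₁)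
    (f : Module.Basis (Fin n₂) F W₂) (α : DecSeq (min n₁ n₂)) : Set (Vertex O F V) :=
  leviOrbit W₁ W₂ (Vertex.mk (repLattice h ϖ e f α))

/-- The orbital distance of two `L`-orbits: the distance in `A^n` of the two sequences with which
the orbits are identified through `repOrbit`. -/
def orbitalDist (h : IsCompl W₁ W₂) (ϖ : O) (e : Module.Basis (Fin n₁) F W₁)
    (f : Module.Basis (Fin n₂) F W₂) (X Y : Set (Vertex O F V)) : ℕ :=
  DecSeq.dist (Function.invFun (repOrbit h ϖ e f) X) (Function.invFun (repOrbit h ϖ e f) Y)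

end Building

end

end EuclideanBuilding

open scoped Pointwise

namespace EuclideanBuilding

/-! ### The module `Q(Λ)` and the exponent of its annihilator. -/

section AnnihilatorExponent

variable {O F V : Type*} [CommRing O] [Field F] [Algebra O F] [AddCommGroup V] [Module F V]
  [Module O V] [IsScalarTower O F V] {W₁ W₂ : Submodule F V}

/-! Write `p` for the projection to `W₁` along `W₂`. Everything rests on one criterion,
`annLog_le_iff`: `d_A([Λ]) ≤ k` if and only if `ϖ ^ k p(Λ) ⊆ Λ`. Since `L` commutes with `p`, the
exponent is constant on `L`-orbits, and it can be read off from `Λ^α`, where the vectors `ϖ ^ (-α_j)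
e_j + f_j` force `k ≥ α_j` and nothing forces more (`annLog_repLattice`).

Classification of orbits. A lattice is an extension of the free module `p₂(Λ)` by `Λ ∩ W₁`, where
`p₂` is the other projection. A splitting turns it into a linear map from `p₂(Λ)` to `W₁`, and Smith
normal form diagonalizes this map by integral changes of basis on both sides, which come from `L`;
this yields some `Λ^α` (`exists_repLattice_eq`). The sequence `α` is an invariant: if `α_k > β_k`,
an element of `L` that carries `Λ^α` to `Λ^β` would, modulo `ϖ`, map `k + 1` independent vectors
into a space of dimension `k` (indices from `0`), although it is an isomorphism of the intersections
with `W₁` (`le_of_image_repLattice_eq`).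

Apartments. A vertex lies in an adapted apartment exactly when a representing lattice is the sum of
its intersections with `W₁` and `W₂`, that is, when `d_A = 0`, that is, when `α = 0`
(`mem_adaptedApartments_iff`). Hence the orbital distance to this orbit is `max α_i = d_A`.

Distance in the `1`-skeleton. Along an edge `d_A` changes by at most one, so `d_A` is a lower bound.
It is attained along the path `(Λ ∩ W₁) + ϖ ^ k Λ`, which reaches an adapted apartment at `k =
d_A([Λ])` (`annLog_towardsApartment`). -/

theorem Vertex.exists_mk_eq (x : Vertex O F V) : ∃ Λ : Lattice O F V, Vertex.mk Λ = x :=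
  Quotient.exists_rep x

theorem Vertex.mk_eq_mk {Λ Λ' : Lattice O F V} :
    Vertex.mk Λ = Vertex.mk Λ' ↔ ∃ a : Fˣ, Λ'.1 = a • Λ.1 :=
  Quotient.eq

theorem projection_add_projection_symm (h : IsCompl W₁ W₂) (v : V) :
    W₁.projection W₂ h v + W₂.projection W₁ h.symm v = v := by
  rw [Submodule.projection_eq_self_sub_projection h.symm]
  simp

theorem smul_projection (h : IsCompl W₁ W₂) (r : O) (v : V) :
    W₁.projection W₂ h (r • v) = r • W₁.projection W₂ h v :=
  ((W₁.projection W₂ h).restrictScalars O).map_smul r v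

/-- The map from `Λ` onto `Q(Λ)` induced by the projection to the first summand. -/
noncomputable def toQMod (h : IsCompl W₁ W₂) (Λ : Lattice O F V) : Λ.1 →ₗ[O] QMod h Λ :=
  Submodule.mkQ _ ∘ₗ ((W₁.projection W₂ h).restrictScalars O).submoduleMap Λ.1

theorem toQMod_surjective (h : IsCompl W₁ W₂) (Λ : Lattice O F V) :
    Function.Surjective (toQMod h Λ) :=
  (Submodule.mkQ_surjective _).comp (LinearMap.submoduleMap_surjective _ _)

theorem mem_ker_toQMod (h : IsCompl W₁ W₂) (Λ : Lattice O F V) (v : Λ.1) :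
    v ∈ LinearMap.ker (toQMod h Λ) ↔ W₁.projection W₂ h v ∈ Λ.1 := by
  change Submodule.Quotient.mk _ = 0 ↔ _
  rw [Submodule.Quotient.mk_eq_zero]
  change _ ∈ kerPart W₁ Λ ↔ _
  rw [kerPart, Submodule.mem_inf]
  exact and_iff_left (Submodule.projection_apply_mem h _)

theorem projection_mem_iff (h : IsCompl W₁ W₂) (Λ : Lattice O F V) {v : V} (hv : v ∈ Λ.1) :
    W₁.projection W₂ h v ∈ Λ.1 ↔ W₂.projection W₁ h.symm v ∈ Λ.1 := by
  have := projection_add_projection_symm h v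
  constructor
  · intro H
    rw [← eq_sub_iff_add_eq'] at this
    exact this ▸ Λ.1.sub_mem hv H
  · intro H
    rw [← eq_sub_iff_add_eq] at this
    exact this ▸ Λ.1.sub_mem hv H

/-- Both modules are quotients of `Λ` by the same submodule: the two components of a vector of `Λ`
add up to it, so one lies in `Λ` as soon as the other does. -/
theorem nonempty_QMod_equiv (h : IsCompl W₁ W₂) (Λ : Lattice O F V) :
    Nonempty (QMod h Λ ≃ₗ[O] QMod h.symm Λ) := by
  have key : LinearMap.ker (toQMod h Λ) = LinearMap.ker (toQMod h.symm Λ) := by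
    ext v
    rw [mem_ker_toQMod, mem_ker_toQMod, projection_mem_iff h Λ v.2]
  exact ⟨((toQMod h Λ).quotKerEquivOfSurjective (toQMod_surjective h Λ)).symm ≪≫ₗ
    Submodule.quotEquivOfEq _ _ key ≪≫ₗ
    (toQMod h.symm Λ).quotKerEquivOfSurjective (toQMod_surjective h.symm Λ)⟩

variable [IsDomain O] [IsDiscreteValuationRing O] [IsFractionRing O F]

theorem exists_pow_smul_mem {ϖ : O} (hϖ : Irreducible ϖ) {U : Type*} [AddCommGroup U] [Module F U]
    [Module O U] [IsScalarTower O F U] {M : Submodule O U}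
    (hM : Submodule.span F (M : Set U) = ⊤) (v : U) : ∃ k : ℕ, ϖ ^ k • v ∈ M := by
  have hv : v ∈ Submodule.span F (M : Set U) := hM ▸ Submodule.mem_top
  induction hv using Submodule.span_induction with
  | mem x hx => exact ⟨0, by simpa using hx⟩
  | zero => exact ⟨0, by simp⟩
  | add x y _ _ hx hy =>
    obtain ⟨k, hk⟩ := hx
    obtain ⟨l, hl⟩ := hy
    refine ⟨k + l, ?_⟩
    rw [smul_add]
    refine M.add_mem ?_ ?_
    · rw [add_comm, pow_add, mul_smul]
      exact M.smul_mem _ hk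
    · rw [pow_add, mul_smul]
      exact M.smul_mem _ hl
  | smul a x _ hx =>
    obtain ⟨k, hk⟩ := hx
    obtain ⟨r, s, hs, rfl⟩ := IsFractionRing.div_surjective (A := O) a
    obtain ⟨l, u, rfl⟩ := IsDiscreteValuationRing.eq_unit_mul_pow_irreducible
      (nonZeroDivisors.ne_zero hs) hϖ
    -- Up to a unit the denominator of the scalar is `ϖ ^ l`, which the additional factor cancels.
    refine ⟨l + k, ?_⟩
    have hl : algebraMap O F ϖ ≠ 0 := by
      simpa using hϖ.ne_zero
    have hu : algebraMap O F u ≠ 0 := by simp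
    have huu : algebraMap O F ↑u⁻¹ * algebraMap O F u = 1 := by rw [← map_mul]; simp
    have : ϖ ^ (l + k) • (algebraMap O F r / algebraMap O F (↑u * ϖ ^ l)) • x
        = (↑u⁻¹ * r) • ϖ ^ k • x := by
      rw [← algebraMap_smul F, smul_smul, ← algebraMap_smul F (↑u⁻¹ * r : O),
        ← algebraMap_smul F (ϖ ^ k), smul_smul]
      congr 1
      simp only [map_mul, map_pow]
      field_simp
      linear_combination (-(algebraMap O F ϖ) ^ (l + k) * algebraMap O F r) * huu
    rw [this]
    exact M.smul_mem _ hk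

theorem exists_forall_pow_smul_mem {ϖ : O} (hϖ : Irreducible ϖ) {U N : Type*} [AddCommGroup U]
    [Module F U] [Module O U] [IsScalarTower O F U] {M : Submodule O U}
    (hM : Submodule.span F (M : Set U) = ⊤) [AddCommGroup N] [Module O N] {L : Submodule O N}
    (hL : L.FG) (φ : N →ₗ[O] U) : ∃ k : ℕ, ∀ v ∈ L, ϖ ^ k • φ v ∈ M := by
  induction L, hL using Submodule.fg_induction with
  | singleton x =>
    obtain ⟨k, hk⟩ := exists_pow_smul_mem hϖ hM (φ x)
    refine ⟨k, fun v hv => ?_⟩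
    obtain ⟨r, rfl⟩ := Submodule.mem_span_singleton.1 hv
    rw [map_smul, smul_comm]
    exact M.smul_mem _ hk
  | sup L₁ L₂ _ _ h₁ h₂ =>
    obtain ⟨k, hk⟩ := h₁
    obtain ⟨l, hl⟩ := h₂
    refine ⟨k + l, fun v hv => ?_⟩
    obtain ⟨x, hx, y, hy, rfl⟩ := Submodule.mem_sup.1 hv
    rw [map_add, smul_add]
    refine M.add_mem ?_ ?_
    · rw [add_comm, pow_add, mul_smul]
      exact M.smul_mem _ (hk x hx)
    · rw [pow_add, mul_smul]
      exact M.smul_mem _ (hl y hy)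

/-- As `O` is not a field, the powers of its maximal ideal strictly decrease, so the infimum in
`logP` is taken over a single exponent. -/
theorem logP_maximalIdeal_pow (k : ℕ) : logP (IsLocalRing.maximalIdeal O ^ k) = k := by
  have hinj : Function.Injective fun k : ℕ => IsLocalRing.maximalIdeal O ^ k :=
    Ideal.pow_right_strictAnti _ (IsDiscreteValuationRing.not_a_field O)
      (IsLocalRing.maximalIdeal.isMaximal O).ne_top |>.injective
  have : {l : ℕ | IsLocalRing.maximalIdeal O ^ k = IsLocalRing.maximalIdeal O ^ l} = {k} := by
    ext l
    exact ⟨fun h => (hinj h).symm, fun h => by rw [Set.mem_singleton_iff.1 h]; rfl⟩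
  rw [logP, this, csInf_singleton]

theorem annihilator_QMod {ϖ : O} (hϖ : Irreducible ϖ) (h : IsCompl W₁ W₂) (Λ : Lattice O F V) :
    Module.annihilator O (QMod h Λ) = IsLocalRing.maximalIdeal O ^ annLog h (Vertex.mk Λ) := by
  obtain ⟨k, hk⟩ := exists_forall_pow_smul_mem hϖ Λ.2.span_eq_top Λ.2.fg
    ((W₁.projection W₂ h).restrictScalars O)
  have hne : Module.annihilator O (QMod h Λ) ≠ ⊥ := fun H => by
    have := (mem_annihilator_QMod h Λ (ϖ ^ k)).2 hk
    rw [H, Ideal.mem_bot] at this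
    exact pow_ne_zero _ hϖ.ne_zero this
  obtain ⟨d, hd⟩ := IsDiscreteValuationRing.ideal_eq_span_pow_irreducible hne hϖ
  rw [← Ideal.span_singleton_pow, ← hϖ.maximalIdeal_eq] at hd
  have : annLog h (Vertex.mk Λ) = d := by
    change logP (Module.annihilator O (QMod h Λ)) = d
    rw [hd, logP_maximalIdeal_pow]
  rw [this, hd]

/-- This criterion replaces the quotient module and its annihilator in all later computations. -/
theorem annLog_le_iff {ϖ : O} (hϖ : Irreducible ϖ) (h : IsCompl W₁ W₂) (Λ : Lattice O F V)
    (k : ℕ) : annLog h (Vertex.mk Λ) ≤ k ↔ ∀ v ∈ Λ.1, ϖ ^ k • W₁.projection W₂ h v ∈ Λ.1 := by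
  rw [← mem_annihilator_QMod, annihilator_QMod hϖ, hϖ.maximalIdeal_eq, Ideal.span_singleton_pow,
    Ideal.mem_span_singleton, pow_dvd_pow_iff hϖ.ne_zero hϖ.not_isUnit]

end AnnihilatorExponent

/-! ### The Levi subgroup and its orbits. -/

section Levi

variable {O F V : Type*} [CommRing O] [Field F] [Algebra O F] [AddCommGroup V] [Module F V]
  [Module O V] [IsScalarTower O F V] {W₁ W₂ : Submodule F V}

theorem levi_apply_mem_left_iff {g : V ≃ₗ[F] V} (hg : g ∈ levi W₁ W₂) {v : V} :
    g v ∈ W₁ ↔ v ∈ W₁ := by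
  conv_lhs => rw [← hg.1]
  simp

theorem levi_apply_mem_right_iff {g : V ≃ₗ[F] V} (hg : g ∈ levi W₁ W₂) {v : V} :
    g v ∈ W₂ ↔ v ∈ W₂ := by
  conv_lhs => rw [← hg.2]
  simp

theorem levi_projection_apply (h : IsCompl W₁ W₂) {g : V ≃ₗ[F] V} (hg : g ∈ levi W₁ W₂) (v : V) :
    W₁.projection W₂ h (g v) = g (W₁.projection W₂ h v) := by
  conv_lhs => rw [← projection_add_projection_symm h v]
  rw [map_add, map_add, Submodule.projection_apply_of_mem_left h
    ((levi_apply_mem_left_iff hg).2 (Submodule.projection_apply_mem _ _)),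
    Submodule.projection_apply_of_mem_right h
    ((levi_apply_mem_right_iff hg).2 (Submodule.projection_apply_mem _ _)), add_zero]

theorem Lattice.apply_mem_image_iff (g : V ≃ₗ[F] V) (Λ : Lattice O F V) {v : V} :
    g v ∈ (Lattice.image g Λ).1 ↔ v ∈ Λ.1 := by
  simp [Lattice.image]

theorem smul_mk (g : V ≃ₗ[F] V) (Λ : Lattice O F V) :
    g • Vertex.mk Λ = Vertex.mk (Lattice.image g Λ) := rfl

theorem mem_leviOrbit_iff {x y : Vertex O F V} :
    y ∈ leviOrbit W₁ W₂ x ↔ ∃ g ∈ levi W₁ W₂, g • x = y := by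
  rw [leviOrbit, MulAction.mem_orbit_iff]
  exact ⟨fun ⟨g, hg⟩ => ⟨g, g.2, hg⟩, fun ⟨g, h, hg⟩ => ⟨⟨g, h⟩, hg⟩⟩

theorem mem_leviOrbit_self (x : Vertex O F V) : x ∈ leviOrbit W₁ W₂ x :=
  MulAction.mem_orbit_self x

theorem leviOrbit_eq_iff {x y : Vertex O F V} :
    leviOrbit W₁ W₂ x = leviOrbit W₁ W₂ y ↔ x ∈ leviOrbit W₁ W₂ y :=
  MulAction.orbit_eq_iff

/-- Homotheties belong to the Levi subgroup, so that two lattices have classes in the same orbit if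
and only if they are conjugate. -/
theorem mk_mem_leviOrbit_mk_iff {Λ Λ' : Lattice O F V} :
    Vertex.mk Λ' ∈ leviOrbit W₁ W₂ (Vertex.mk Λ) ↔
      ∃ g ∈ levi W₁ W₂, Lattice.image g Λ = Λ' := by
  rw [mem_leviOrbit_iff]
  constructor
  · rintro ⟨g, hg, H⟩
    rw [smul_mk, Vertex.mk_eq_mk] at H
    obtain ⟨a, ha⟩ := H
    have hmap : ∀ W : Submodule F V, W.map (g : V →ₗ[F] V) = W →
        W.map ((g.trans (LinearEquiv.smulOfUnit a) : V ≃ₗ[F] V) : V →ₗ[F] V) = W := by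
      intro W hW
      rw [LinearEquiv.coe_trans, Submodule.map_comp, hW]
      ext v
      constructor
      · rintro ⟨w, hw, rfl⟩
        exact W.smul_mem (a : F) hw
      · intro hv
        exact ⟨(a⁻¹ : Fˣ) • v, W.smul_mem ((a⁻¹ : Fˣ) : F) hv, smul_inv_smul a v⟩
    refine ⟨g.trans (LinearEquiv.smulOfUnit a), ⟨hmap _ hg.1, hmap _ hg.2⟩, Subtype.ext ?_⟩
    rw [ha]
    ext v
    constructor
    · rintro ⟨w, hw, rfl⟩
      exact Submodule.smul_mem_pointwise_smul _ _ _ ⟨w, hw, rfl⟩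
    · rintro ⟨_, ⟨w, hw, rfl⟩, rfl⟩
      exact ⟨w, hw, rfl⟩
  · rintro ⟨g, hg, rfl⟩
    exact ⟨g, hg, rfl⟩

variable [IsDomain O] [IsDiscreteValuationRing O] [IsFractionRing O F]

theorem annLog_smul (h : IsCompl W₁ W₂) {g : V ≃ₗ[F] V} (hg : g ∈ levi W₁ W₂)
    (x : Vertex O F V) : annLog h (g • x) = annLog h x := by
  obtain ⟨Λ, rfl⟩ := x.exists_mk_eq
  obtain ⟨ϖ, hϖ⟩ := IsDiscreteValuationRing.exists_irreducible O
  rw [smul_mk]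
  refine eq_of_forall_ge_iff fun k => ?_
  rw [annLog_le_iff hϖ, annLog_le_iff hϖ]
  have key : ∀ v, ϖ ^ k • W₁.projection W₂ h (g v) = g (ϖ ^ k • W₁.projection W₂ h v) := by
    intro v
    rw [levi_projection_apply h hg]
    exact (((g : V →ₗ[F] V).restrictScalars O).map_smul _ _).symm
  constructor
  · intro H v hv
    have := H (g v) ((Lattice.apply_mem_image_iff g Λ).2 hv)
    rwa [key, Lattice.apply_mem_image_iff] at this
  · rintro H _ ⟨v, hv, rfl⟩
    change ϖ ^ k • W₁.projection W₂ h (g v) ∈ _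
    rw [key, Lattice.apply_mem_image_iff]
    exact H v hv

theorem annLog_eq_of_mem_leviOrbit (h : IsCompl W₁ W₂) {x y : Vertex O F V}
    (hy : y ∈ leviOrbit W₁ W₂ x) : annLog h y = annLog h x := by
  obtain ⟨g, hg, rfl⟩ := mem_leviOrbit_iff.1 hy
  exact annLog_smul h hg x

end Levi

end EuclideanBuilding

namespace EuclideanBuilding

/-! ### The lattices `Λ^α`: their exponents, and why distinct sequences give distinct orbits. -/

section RepLattice

variable {O F V : Type*} [CommRing O] [Field F] [Algebra O F] [AddCommGroup V] [Module F V]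
  {W₁ W₂ : Submodule F V} {n₁ n₂ : ℕ}

/-- The coordinates of the component in `W₁` with respect to a basis of `W₁`. -/
noncomputable def coordFst (h : IsCompl W₁ W₂) (e : Module.Basis (Fin n₁) F W₁) (i : Fin n₁) :
    V →ₗ[F] F :=
  e.coord i ∘ₗ W₁.projectionOnto W₂ h

theorem coordFst_basis (h : IsCompl W₁ W₂) (e : Module.Basis (Fin n₁) F W₁) (i j : Fin n₁) :
    coordFst h e i (e j) = if j = i then 1 else 0 := by
  rw [coordFst, LinearMap.comp_apply, Submodule.projectionOnto_apply_left, Module.Basis.coord_apply,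
    Module.Basis.repr_self, Finsupp.single_apply]

theorem coordFst_of_mem_right (h : IsCompl W₁ W₂) (e : Module.Basis (Fin n₁) F W₁) (i : Fin n₁)
    {v : V} (hv : v ∈ W₂) : coordFst h e i v = 0 := by
  rw [coordFst, LinearMap.comp_apply, Submodule.projectionOnto_apply_of_mem_right h hv, map_zero]

theorem coordFst_projection (h : IsCompl W₁ W₂) (e : Module.Basis (Fin n₁) F W₁) (i : Fin n₁)
    (v : V) : coordFst h e i (W₁.projection W₂ h v) = coordFst h e i v := by
  rw [Submodule.projection_apply, coordFst, LinearMap.comp_apply,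
    Submodule.projectionOnto_apply_left, LinearMap.comp_apply]

theorem sum_coordFst_smul (h : IsCompl W₁ W₂) (e : Module.Basis (Fin n₁) F W₁) {v : V}
    (hv : v ∈ W₁) : ∑ i, coordFst h e i v • (e i : V) = v := by
  have := congrArg Subtype.val (e.sum_repr ⟨v, hv⟩)
  simp only [AddSubmonoidClass.coe_finsetSum, Submodule.coe_smul] at this
  conv_rhs => rw [← this]
  refine Finset.sum_congr rfl fun i _ => ?_
  rw [coordFst, LinearMap.comp_apply, Submodule.projectionOnto_apply_of_mem_left h hv,
    Module.Basis.coord_apply]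

theorem repVec_sub_mem (ϖ : O) (e : Module.Basis (Fin n₁) F W₁)
    (f : Module.Basis (Fin n₂) F W₂) (α : DecSeq (min n₁ n₂)) (j : Fin n₂) :
    repVec ϖ e f α j - f j ∈ W₁ := by
  unfold repVec
  split_ifs with hj
  · rw [add_sub_cancel_right]
    exact W₁.smul_mem _ (e _).2
  · simp

theorem coordFst_repVec (h : IsCompl W₁ W₂) (ϖ : O) (e : Module.Basis (Fin n₁) F W₁)
    (f : Module.Basis (Fin n₂) F W₂) (α : DecSeq (min n₁ n₂)) (i : Fin n₁) (j : Fin n₂) :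
    coordFst h e i (repVec ϖ e f α j) =
      if hij : j.1 = i.1 then
        (algebraMap O F ϖ) ^ (-(α.1 ⟨j.1, lt_min (hij ▸ i.2) j.2⟩ : ℤ)) else 0 := by
  unfold repVec
  split_ifs with hj hij hij
  · rw [map_add, map_smul, coordFst_basis, coordFst_of_mem_right h e i (f j).2, if_pos]
    · simp
    · exact Fin.ext hij
  · rw [map_add, map_smul, coordFst_basis, coordFst_of_mem_right h e i (f j).2, if_neg]
    · simp
    · exact fun H => hij (congrArg Fin.val H)
  · exact absurd (hij ▸ i.2) hj
  · exact coordFst_of_mem_right h e i (f j).2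

theorem projection_repVec (h : IsCompl W₁ W₂) (ϖ : O)
    (e : Module.Basis (Fin n₁) F W₁) (f : Module.Basis (Fin n₂) F W₂) (α : DecSeq (min n₁ n₂))
    (j : Fin (min n₁ n₂)) :
    W₁.projection W₂ h (repVec ϖ e f α (j.castLE (min_le_right _ _))) =
      algebraMap O F ϖ ^ (-(α.1 j : ℤ)) • (e (j.castLE (min_le_left _ _)) : V) := by
  have hj : j.1 < n₁ := j.2.trans_le (min_le_left _ _)
  rw [repVec, dif_pos (show (j.castLE (min_le_right n₁ n₂)).1 < n₁ from hj), map_add, map_smul,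
    Submodule.projection_apply_left, Submodule.projection_apply_right, add_zero]
  rfl

theorem algebraMap_uniformizer_ne_zero (F : Type*) [Field F] [Algebra O F] [IsDomain O]
    [IsFractionRing O F] {ϖ : O} (hϖ : Irreducible ϖ) : algebraMap O F ϖ ≠ 0 := by
  simpa using hϖ.ne_zero

variable [Module O V] [IsScalarTower O F V]

theorem map_smul_tower (φ : V →ₗ[F] F) (r : O) (v : V) : φ (r • v) = algebraMap O F r * φ v := by
  rw [← algebraMap_smul F r v, map_smul, smul_eq_mul]

theorem basis_mem_repLattice (h : IsCompl W₁ W₂) (ϖ : O) (e : Module.Basis (Fin n₁) F W₁)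
    (f : Module.Basis (Fin n₂) F W₂) (α : DecSeq (min n₁ n₂)) (i : Fin n₁) :
    (e i : V) ∈ (repLattice h ϖ e f α).1 :=
  Submodule.subset_span (Or.inl ⟨i, rfl⟩)

theorem repVec_mem_repLattice (h : IsCompl W₁ W₂) (ϖ : O) (e : Module.Basis (Fin n₁) F W₁)
    (f : Module.Basis (Fin n₂) F W₂) (α : DecSeq (min n₁ n₂)) (j : Fin n₂) :
    repVec ϖ e f α j ∈ (repLattice h ϖ e f α).1 :=
  Submodule.subset_span (Or.inr ⟨j, rfl⟩)

theorem mem_repLattice_iff_exists (h : IsCompl W₁ W₂) (ϖ : O) (e : Module.Basis (Fin n₁) F W₁)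
    (f : Module.Basis (Fin n₂) F W₂) (α : DecSeq (min n₁ n₂)) {v : V} :
    v ∈ (repLattice h ϖ e f α).1 ↔ ∃ (a : Fin n₁ → O) (b : Fin n₂ → O),
      v = ∑ i, a i • (e i : V) + ∑ j, b j • repVec ϖ e f α j := by
  change v ∈ Submodule.span O _ ↔ _
  rw [Submodule.span_union, Submodule.mem_sup]
  simp only [Submodule.mem_span_range_iff_exists_fun]
  constructor
  · rintro ⟨_, ⟨a, rfl⟩, _, ⟨b, rfl⟩, rfl⟩
    exact ⟨a, b, rfl⟩
  · rintro ⟨a, b, rfl⟩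
    exact ⟨_, ⟨a, rfl⟩, _, ⟨b, rfl⟩, rfl⟩

variable [IsDomain O] [IsFractionRing O F]

/-- `Λ^α ∩ W₁` is the lattice spanned by the basis of `W₁`. -/
theorem mem_repLattice_iff_of_mem_left (h : IsCompl W₁ W₂) (ϖ : O)
    (e : Module.Basis (Fin n₁) F W₁) (f : Module.Basis (Fin n₂) F W₂) (α : DecSeq (min n₁ n₂))
    {v : V} (hv : v ∈ W₁) :
    v ∈ (repLattice h ϖ e f α).1 ↔ ∀ i, ∃ r : O, coordFst h e i v = algebraMap O F r := by
  constructor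
  · intro H i
    obtain ⟨a, b, rfl⟩ := (mem_repLattice_iff_exists h ϖ e f α).1 H
    -- The `f_j`-coordinate of the combination is `b j`, and it vanishes on `W₁`.
    have hb : ∀ j, b j = 0 := by
      intro j
      have hj := coordFst_of_mem_right h.symm f j hv
      rw [map_add, map_sum, map_sum, Finset.sum_eq_zero, zero_add, Finset.sum_eq_single j] at hj
      · rw [map_smul_tower, ← sub_add_cancel (repVec ϖ e f α j) (f j : V), map_add,
          coordFst_of_mem_right h.symm f j (repVec_sub_mem ϖ e f α j), coordFst_basis] at hj
        simpa using hj
      · intro k _ hk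
        rw [map_smul_tower, ← sub_add_cancel (repVec ϖ e f α k) (f k : V), map_add,
          coordFst_of_mem_right h.symm f j (repVec_sub_mem ϖ e f α k), coordFst_basis, if_neg hk]
        simp
      · simp
      · intro k _
        rw [map_smul_tower, coordFst_of_mem_right h.symm f j (e k).2, mul_zero]
    refine ⟨a i, ?_⟩
    rw [map_add, map_sum, map_sum, Finset.sum_eq_single i]
    · rw [map_smul_tower, coordFst_basis]
      simp [hb]
    · intro k _ hk
      rw [map_smul_tower, coordFst_basis, if_neg hk, mul_zero]
    · simp
  · intro H
    rw [← sum_coordFst_smul h e hv]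
    refine Submodule.sum_mem _ fun i _ => ?_
    obtain ⟨r, hr⟩ := H i
    rw [hr, algebraMap_smul]
    exact Submodule.smul_mem _ _ (basis_mem_repLattice h ϖ e f α i)

/-- Only the generator with index `i` contributes a denominator to the coordinate `i`, namely `ϖ ^
α_i`; for `i ≥ n₂` there is none. Bounding each coordinate separately is what the comparison of two
sequences needs. -/
theorem pow_mul_coordFst_mem (h : IsCompl W₁ W₂) {ϖ : O} (hϖ : Irreducible ϖ)
    (e : Module.Basis (Fin n₁) F W₁) (f : Module.Basis (Fin n₂) F W₂) (α : DecSeq (min n₁ n₂))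
    {v : V} (hv : v ∈ (repLattice h ϖ e f α).1) (i : Fin n₁) {k : ℕ}
    (hk : ∀ hi : i.1 < n₂, α.1 ⟨i.1, lt_min i.2 hi⟩ ≤ k) :
    ∃ r : O, algebraMap O F ϖ ^ k * coordFst h e i v = algebraMap O F r := by
  have h0 := algebraMap_uniformizer_ne_zero F hϖ
  induction hv using Submodule.span_induction with
  | mem x hx =>
    rcases hx with ⟨j, rfl⟩ | ⟨j, rfl⟩
    · refine ⟨if j = i then ϖ ^ k else 0, ?_⟩
      simp only [coordFst_basis]
      split_ifs <;> simp
    · rw [coordFst_repVec]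
      split_ifs with hij
      · have hi : i.1 < n₂ := hij ▸ j.2
        have hji : (⟨j.1, lt_min (hij ▸ i.2) j.2⟩ : Fin (min n₁ n₂)) = ⟨i.1, lt_min i.2 hi⟩ :=
          Fin.ext hij
        refine ⟨ϖ ^ (k - α.1 ⟨i.1, lt_min i.2 hi⟩), ?_⟩
        rw [hji, zpow_neg, zpow_natCast, map_pow, ← div_eq_mul_inv, pow_sub₀ _ h0 (hk hi),
          div_eq_mul_inv]
      · exact ⟨0, by simp⟩
  | zero => exact ⟨0, by simp⟩
  | add x y _ _ hx hy =>
    obtain ⟨r, hr⟩ := hx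
    obtain ⟨s, hs⟩ := hy
    exact ⟨r + s, by rw [map_add, mul_add, hr, hs, map_add]⟩
  | smul a x _ hx =>
    obtain ⟨r, hr⟩ := hx
    exact ⟨a * r, by rw [map_smul_tower, mul_left_comm, hr, map_mul]⟩

variable [IsDiscreteValuationRing O]

theorem annLog_repLattice (h : IsCompl W₁ W₂) {ϖ : O} (hϖ : Irreducible ϖ)
    (e : Module.Basis (Fin n₁) F W₁) (f : Module.Basis (Fin n₂) F W₂) (α : DecSeq (min n₁ n₂)) :
    annLog h (Vertex.mk (repLattice h ϖ e f α)) = Finset.univ.sup α.1 := by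
  have h0 := algebraMap_uniformizer_ne_zero F hϖ
  refine eq_of_forall_ge_iff fun k => ?_
  rw [annLog_le_iff hϖ, Finset.sup_le_iff]
  constructor
  · intro H j _
    have hj := H _ (repVec_mem_repLattice h ϖ e f α (j.castLE (min_le_right _ _)))
    rw [mem_repLattice_iff_of_mem_left h ϖ e f α] at hj
    · obtain ⟨r, hr⟩ := hj (j.castLE (min_le_left _ _))
      rw [projection_repVec, map_smul_tower, map_smul, coordFst_basis, if_pos rfl,
        smul_eq_mul, mul_one, zpow_neg, zpow_natCast, ← div_eq_mul_inv,
        div_eq_iff (pow_ne_zero _ h0), ← map_pow, ← map_mul] at hr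
      have := IsFractionRing.injective O F hr
      rw [← pow_dvd_pow_iff hϖ.ne_zero hϖ.not_isUnit, this]
      exact dvd_mul_left _ _
    · exact (W₁.restrictScalars O).smul_mem _ (Submodule.projection_apply_mem h _)
  · intro H v hv
    rw [mem_repLattice_iff_of_mem_left h ϖ e f α
      ((W₁.restrictScalars O).smul_mem _ (Submodule.projection_apply_mem h _))]
    intro i
    rw [map_smul_tower, coordFst_projection, map_pow]
    exact pow_mul_coordFst_mem h hϖ e f α hv i fun hi => H _ (Finset.mem_univ _)

/-- Since `g` respects intersections with `W₁`, its matrix `T` in the basis `e` is integral. Since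
it also respects projections to `W₁`, the vector `ϖ ^ (-α_m) g(e_m)` has its coordinate `i` in `ϖ ^
(-β_i) O`. If `α_k > β_k`, then `α_m > β_i` for `m ≤ k ≤ i`, so these entries of `T` vanish modulo
`ϖ`. The images of `e_0, ..., e_k` are then dependent modulo `ϖ`, against the injectivity of `g`
modulo `ϖ`. -/
theorem le_of_image_repLattice_eq (h : IsCompl W₁ W₂) {ϖ : O} (hϖ : Irreducible ϖ)
    (e : Module.Basis (Fin n₁) F W₁) (f : Module.Basis (Fin n₂) F W₂) {α β : DecSeq (min n₁ n₂)}
    {g : V ≃ₗ[F] V} (hg : g ∈ levi W₁ W₂)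
    (H : Lattice.image g (repLattice h ϖ e f α) = repLattice h ϖ e f β) (k : Fin (min n₁ n₂)) :
    α.1 k ≤ β.1 k := by
  by_contra! hlt
  have h0 := algebraMap_uniformizer_ne_zero F hϖ
  have hmem : ∀ v, g v ∈ (repLattice h ϖ e f β).1 ↔ v ∈ (repLattice h ϖ e f α).1 := fun v => by
    rw [← H, Lattice.apply_mem_image_iff]
  have hW : ∀ {v}, v ∈ W₁ → g v ∈ W₁ := fun hv => (levi_apply_mem_left_iff hg).2 hv
  have hkn : k.1 < n₁ := k.2.trans_le (min_le_left _ _)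
  choose T hT using fun j => (mem_repLattice_iff_of_mem_left h ϖ e f β (hW (e j).2)).1
    ((hmem _).2 (basis_mem_repLattice h ϖ e f α j))
  -- the lower left block of the transition matrix vanishes modulo the maximal ideal
  have hblock : ∀ j i, j.1 ≤ k.1 → k.1 ≤ i.1 → ϖ ∣ T j i := by
    intro j i hj hi
    obtain ⟨m, rfl⟩ : ∃ m : Fin (min n₁ n₂), m.castLE (min_le_left _ _) = j :=
      ⟨⟨j.1, hj.trans_lt k.2⟩, rfl⟩
    have hmk : α.1 k ≤ α.1 m := α.2 hj
    obtain ⟨r, hr⟩ := pow_mul_coordFst_mem h hϖ e f β ((hmem _).2 (repVec_mem_repLattice h ϖ e f α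
      (m.castLE (min_le_right _ _)))) i (k := β.1 k) fun hi' => β.2 hi
    rw [← coordFst_projection, levi_projection_apply h hg, projection_repVec,
      map_smul, map_smul, hT, smul_eq_mul, zpow_neg, zpow_natCast, mul_left_comm,
      inv_mul_eq_iff_eq_mul₀ (pow_ne_zero _ h0), ← map_pow, ← map_pow, ← map_mul, ← map_mul] at hr
    have hr' := IsFractionRing.injective O F hr
    obtain ⟨d, hd⟩ : ∃ d, α.1 m = β.1 k + (d + 1) := ⟨α.1 m - β.1 k - 1, by omega⟩
    rw [hd, pow_add, mul_assoc] at hr'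
    rw [mul_left_cancel₀ (pow_ne_zero _ hϖ.ne_zero) hr', pow_succ', mul_assoc]
    exact dvd_mul_right _ _
  -- Over the residue field there are `k + 1` unknowns and only `k` equations, those of the
  -- coordinates below `k`; the others hold by `hblock`.
  have hker := LinearMap.ker_ne_bot_of_finrank_lt
    (f := Matrix.mulVecLin (Matrix.of fun (i : Fin k.1) (j : Fin (k.1 + 1)) =>
      IsLocalRing.residue O (T (j.castLE hkn) (i.castLE hkn.le)))) (by simp)
  obtain ⟨c', hc', hne⟩ := (Submodule.ne_bot_iff _).1 hker
  choose c hc using fun j => IsLocalRing.residue_surjective (R := O) (c' j)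
  refine hne (funext fun j => ?_)
  rw [LinearMap.mem_ker] at hc'
  have hdvd : ∀ r : O, IsLocalRing.residue O r = 0 ↔ ϖ ∣ r := fun r => by
    rw [IsLocalRing.residue_eq_zero_iff, hϖ.maximalIdeal_eq, Ideal.mem_span_singleton]
  have hsum : ∀ i, ϖ ∣ ∑ j : Fin (k.1 + 1), c j * T (j.castLE hkn) i := by
    intro i
    by_cases hi : i.1 < k.1
    · rw [← hdvd, map_sum]
      have := congrFun hc' ⟨i.1, hi⟩
      simp only [Matrix.mulVecLin_apply, Matrix.mulVec, dotProduct, Matrix.of_apply,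
        Pi.zero_apply] at this
      rw [← this]
      refine Finset.sum_congr rfl fun j _ => ?_
      rw [map_mul, hc, mul_comm]
      rfl
    · exact Finset.dvd_sum fun j _ => Dvd.dvd.mul_left
        (hblock _ _ (Nat.lt_succ_iff.1 j.2) (not_lt.1 hi)) _
  set v : V := ∑ j : Fin (k.1 + 1), c j • (e (j.castLE hkn) : V) with hv
  have hvW : v ∈ W₁ := Submodule.sum_mem _ fun j _ => (W₁.restrictScalars O).smul_mem _ (e _).2
  -- Pulling this membership back by `g` shows that `ϖ⁻¹ v` lies in `Λ^α`, so every `c j` is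
  -- divisible by `ϖ` and the kernel vector `c'` is zero.
  have hgv : (algebraMap O F ϖ)⁻¹ • g v ∈ (repLattice h ϖ e f β).1 := by
    rw [mem_repLattice_iff_of_mem_left h ϖ e f β (W₁.smul_mem _ (hW hvW))]
    intro i
    obtain ⟨r, hr⟩ := hsum i
    refine ⟨r, ?_⟩
    have : coordFst h e i (g v) = algebraMap O F (ϖ * r) := by
      rw [← hr, hv, map_sum, map_sum, map_sum]
      refine Finset.sum_congr rfl fun j _ => ?_
      rw [map_mul, ← hT]
      exact map_smul_tower (coordFst h e i ∘ₗ (g : V →ₗ[F] V)) _ _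
    rw [map_smul, this, map_mul, smul_eq_mul, inv_mul_cancel_left₀ h0]
  rw [← map_smul, hmem, mem_repLattice_iff_of_mem_left h ϖ e f α (W₁.smul_mem _ hvW)] at hgv
  obtain ⟨r, hr⟩ := hgv (j.castLE hkn)
  have hcoord : coordFst h e (j.castLE hkn) v = algebraMap O F (c j) := by
    rw [hv, map_sum, Finset.sum_eq_single j]
    · rw [map_smul_tower, coordFst_basis, if_pos rfl, mul_one]
    · intro l _ hl
      rw [map_smul_tower, coordFst_basis, if_neg, mul_zero]
      exact fun H => hl (Fin.castLE_injective _ H)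
    · simp
  rw [map_smul, hcoord, smul_eq_mul, inv_mul_eq_iff_eq_mul₀ h0, ← map_mul] at hr
  rw [← hc, Pi.zero_apply, hdvd, IsFractionRing.injective O F hr]
  exact dvd_mul_right _ _

theorem repOrbit_injective (h : IsCompl W₁ W₂) {ϖ : O} (hϖ : Irreducible ϖ)
    (e : Module.Basis (Fin n₁) F W₁) (f : Module.Basis (Fin n₂) F W₂) :
    Function.Injective (repOrbit (O := O) h ϖ e f) := by
  have key : ∀ α β, repOrbit (O := O) h ϖ e f α = repOrbit h ϖ e f β → ∀ k, α.1 k ≤ β.1 k := by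
    intro α β H k
    rw [repOrbit, repOrbit, eq_comm, leviOrbit_eq_iff, mk_mem_leviOrbit_mk_iff] at H
    obtain ⟨g, hg, H⟩ := H
    exact le_of_image_repLattice_eq h hϖ e f hg H k
  exact fun α β H => Subtype.ext (funext fun k =>
    le_antisymm (key α β H k) (key β α H.symm k))

end RepLattice

end EuclideanBuilding

namespace EuclideanBuilding

/-! ### Smith normal form with ordered elementary divisors. -/

section SmithNormalForm

theorem exists_equiv_extending_embedding {ι : Type*} [Fintype ι] {m n : ℕ}
    (hn : Fintype.card ι = n) (i : Fin m ↪ ι) :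
    ∃ ε : Fin n ≃ ι, ∀ (k : Fin m) (hk : k.1 < n), ε ⟨k.1, hk⟩ = i k := by
  classical
  obtain ⟨ε, hε⟩ := Finset.exists_equiv_extend_of_card_eq (α := Fin n) (β := ι)
    (t := Finset.univ) (s := Finset.univ.filter fun k => k.1 < m)
    -- The value for `k ≥ m` is arbitrary, as only the indices below `m` are prescribed.
    (f := fun k => if hk : k.1 < m then i ⟨k.1, hk⟩ else (Fintype.equivFinOfCardEq hn).symm k)
    (by simp [hn]) (Finset.subset_univ _) (by
      intro x hx y hy hxy
      have hx' : x.1 < m := by simpa using hx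
      have hy' : y.1 < m := by simpa using hy
      simp only [hx', hy', dif_pos] at hxy
      exact Fin.ext (Fin.mk.inj (i.injective hxy)))
  refine ⟨ε.trans (Equiv.subtypeUnivEquiv fun _ => Finset.mem_univ _), fun k hk => ?_⟩
  have := hε ⟨k.1, hk⟩ (by simp)
  simpa using this

variable {R A B : Type*} [CommRing R] [IsDomain R] [IsPrincipalIdealRing R]
  [AddCommGroup A] [Module R A] [Module.Free R A] [Module.Finite R A]
  [AddCommGroup B] [Module R B] [Module.Free R B] [Module.Finite R B]

/-- Smith normal form of a linear map between free modules of finite rank. -/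
theorem exists_smith_bases (φ : A →ₗ[R] B) :
    ∃ (r s t : ℕ) (a : Fin r → R) (i : Fin r ↪ Fin t) (bA : Module.Basis (Fin r ⊕ Fin s) R A)
      (bB : Module.Basis (Fin t) R B), (∀ k, a k ≠ 0) ∧
      (∀ k, φ (bA (Sum.inl k)) = a k • bB (i k)) ∧ ∀ l, φ (bA (Sum.inr l)) = 0 := by
  obtain ⟨r, snf⟩ := Submodule.smithNormalForm (Module.finBasis R B) (LinearMap.range φ)
  obtain ⟨σ, hσ⟩ := Module.projective_lifting_property φ.rangeRestrict LinearMap.id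
    φ.surjective_rangeRestrict
  have hσ' : ∀ y, φ (σ y) = y := fun y => congrArg Subtype.val (LinearMap.congr_fun hσ y)
  let bK := Module.finBasis R (LinearMap.ker φ)
  let u : Fin r ⊕ Fin (Module.finrank R (LinearMap.ker φ)) → A :=
    Sum.elim (fun k => σ (snf.bN k)) fun l => (bK l : A)
  have hli : LinearIndependent R u := by
    rw [linearIndependent_sum]
    refine ⟨?_, ?_, ?_⟩
    · refine LinearIndependent.of_comp φ.rangeRestrict ?_
      have : φ.rangeRestrict ∘ u ∘ Sum.inl = snf.bN := by
        ext k
        simp [u, hσ']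
      rw [this]
      exact snf.bN.linearIndependent
    · exact bK.linearIndependent.map' (LinearMap.ker φ).subtype (Submodule.ker_subtype _)
    · rw [Submodule.disjoint_def]
      intro x hx hx'
      have h1 : x ∈ LinearMap.range σ := by
        refine Submodule.span_le.2 ?_ hx
        rintro _ ⟨k, rfl⟩
        exact ⟨_, rfl⟩
      have h2 : x ∈ LinearMap.ker φ := by
        refine Submodule.span_le.2 ?_ hx'
        rintro _ ⟨k, rfl⟩
        exact (bK k).2
      obtain ⟨y, rfl⟩ := h1
      rw [LinearMap.mem_ker, hσ', Submodule.coe_eq_zero] at h2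
      rw [h2, map_zero]
  have hsp : ⊤ ≤ Submodule.span R (Set.range u) := by
    intro x _
    have h1 : σ (φ.rangeRestrict x) ∈ Submodule.span R (Set.range u) := by
      rw [← snf.bN.sum_repr (φ.rangeRestrict x), map_sum]
      refine Submodule.sum_mem _ fun k _ => ?_
      rw [map_smul]
      exact Submodule.smul_mem _ _ (Submodule.subset_span ⟨Sum.inl k, rfl⟩)
    have h2 : x - σ (φ.rangeRestrict x) ∈ LinearMap.ker φ := by
      rw [LinearMap.mem_ker, map_sub, hσ', LinearMap.codRestrict_apply, sub_self]
    have h3 : x - σ (φ.rangeRestrict x) ∈ Submodule.span R (Set.range u) := by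
      have := congrArg Subtype.val (bK.sum_repr ⟨_, h2⟩)
      rw [← show _ = x - σ (φ.rangeRestrict x) from this]
      simp only [AddSubmonoidClass.coe_finsetSum, Submodule.coe_smul]
      exact Submodule.sum_mem _ fun l _ =>
        Submodule.smul_mem _ _ (Submodule.subset_span ⟨Sum.inr l, rfl⟩)
    simpa using Submodule.add_mem _ h3 h1
  refine ⟨r, _, _, snf.a, snf.f, Module.Basis.mk hli hsp, snf.bM, ?_, ?_, ?_⟩
  · intro k hk
    have := snf.snf k
    rw [hk, zero_smul, Submodule.coe_eq_zero] at this
    exact snf.bN.ne_zero k this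
  · intro k
    rw [Module.Basis.mk_apply]
    simp [u, hσ', snf.snf]
  · intro l
    rw [Module.Basis.mk_apply]
    exact (bK l).2

/-- Over a discrete valuation ring the bases of the Smith normal form can be chosen such that the
elementary divisors are powers of a uniformizer and, beyond the rank, vanish; they are ordered by
increasing divisibility. -/
theorem exists_ordered_smith_bases {O A B : Type*} [CommRing O] [IsDomain O]
    [IsDiscreteValuationRing O] [AddCommGroup A] [Module O A] [Module.Free O A] [Module.Finite O A]
    [AddCommGroup B] [Module O B] [Module.Free O B] [Module.Finite O B]
    {ϖ : O} (hϖ : Irreducible ϖ) {n₁ n₂ : ℕ}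
    (h₁ : Module.finrank O B = n₁) (h₂ : Module.finrank O A = n₂) (φ : A →ₗ[O] B) :
    ∃ (r : ℕ) (c : Fin r → ℕ) (bA : Module.Basis (Fin n₂) O A) (bB : Module.Basis (Fin n₁) O B),
      r ≤ n₁ ∧ Monotone c ∧
      (∀ (k : Fin r) (hk₁ : k.1 < n₁) (hk₂ : k.1 < n₂),
        φ (bA ⟨k.1, hk₂⟩) = ϖ ^ c k • bB ⟨k.1, hk₁⟩) ∧
      ∀ l : Fin n₂, r ≤ l.1 → φ (bA l) = 0 := by
  classical
  obtain ⟨r, s, t, a, i, bA, bB, ha, hφ, hφ'⟩ := exists_smith_bases φ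
  choose c u hu using fun k => IsDiscreteValuationRing.eq_unit_mul_pow_irreducible (ha k) hϖ
  -- absorb the units into the basis of the target
  let w : Fin t → Oˣ := fun j => if hj : ∃ k, i k = j then u hj.choose else 1
  have hw : ∀ k, w (i k) = u k := by
    intro k
    have hk : ∃ k', i k' = i k := ⟨k, rfl⟩
    simp only [w, dif_pos hk]
    rw [i.injective hk.choose_spec]
  let bB' := bB.unitsSMul w
  have hφ'' : ∀ k, φ (bA (Sum.inl k)) = ϖ ^ c k • bB' (i k) := by
    intro k
    rw [hφ, Module.Basis.unitsSMul_apply, hw, hu, Units.smul_def, smul_smul, mul_comm]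
  have hct : Fintype.card (Fin t) = n₁ := by
    rw [← h₁, Module.finrank_eq_card_basis bB]
  have hcA : Fintype.card (Fin r ⊕ Fin s) = n₂ := by
    rw [← h₂, Module.finrank_eq_card_basis bA]
  -- Sorting the exponents and extending both index embeddings to bijections places the `k`-th
  -- elementary divisor at the index `k` of either basis.
  let ρ := Tuple.sort c
  obtain ⟨ε₁, hε₁⟩ := exists_equiv_extending_embedding hct (ρ.toEmbedding.trans i)
  obtain ⟨ε₂, hε₂⟩ := exists_equiv_extending_embedding hcA
    (ρ.toEmbedding.trans (⟨Sum.inl, Sum.inl_injective⟩ : Fin r ↪ Fin r ⊕ Fin s))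
  have hr₂ : r ≤ n₂ := by
    rw [← hcA]
    simp
  refine ⟨r, c ∘ ρ, bA.reindex ε₂.symm, bB'.reindex ε₁.symm, ?_, Tuple.monotone_sort c, ?_, ?_⟩
  · simpa [← hct] using Fintype.card_le_of_embedding i
  · intro k hk₁ hk₂
    rw [Module.Basis.reindex_apply, Module.Basis.reindex_apply, Equiv.symm_symm, Equiv.symm_symm,
      hε₁, hε₂]
    exact hφ'' (ρ k)
  · intro l hl
    rw [Module.Basis.reindex_apply, Equiv.symm_symm]
    rcases hl' : ε₂ l with k | m
    -- The value `inl k` is already taken at the index `ρ.symm k`, which is below `r`.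
    · have := hε₂ (ρ.symm k) ((ρ.symm k).2.trans_le hr₂)
      rw [Function.Embedding.trans_apply, Equiv.coe_toEmbedding, Equiv.apply_symm_apply] at this
      have := ε₂.injective (hl'.trans this.symm)
      rw [this] at hl
      exact absurd (ρ.symm k).2 (not_lt.2 hl)
    · exact hφ' m

end SmithNormalForm

end EuclideanBuilding

namespace EuclideanBuilding

/-! ### Every orbit contains some `Λ^α`. -/

section OrbitRepresentatives

variable {O F V : Type*} [CommRing O] [Field F] [Algebra O F] [AddCommGroup V] [Module F V]
  [Module O V] [IsScalarTower O F V] {W₁ W₂ : Submodule F V} {n₁ n₂ : ℕ}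

theorem exists_levi_of_bases (h : IsCompl W₁ W₂)
    (e e' : Module.Basis (Fin n₁) F W₁) (f f' : Module.Basis (Fin n₂) F W₂) :
    ∃ g ∈ levi W₁ W₂, (∀ i, g (e i) = e' i) ∧ ∀ j, g (f j) = f' j := by
  let g₁ : W₁ ≃ₗ[F] W₁ := e.equiv e' (Equiv.refl _)
  let g₂ : W₂ ≃ₗ[F] W₂ := f.equiv f' (Equiv.refl _)
  let p := W₁.prodEquivOfIsCompl W₂ h
  let g : V ≃ₗ[F] V := p.symm ≪≫ₗ (g₁.prodCongr g₂) ≪≫ₗ p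
  have h₁ : ∀ w : W₁, g w = g₁ w := by
    intro w
    simp [g, p]
  have h₂ : ∀ w : W₂, g w = g₂ w := by
    intro w
    simp [g, p]
  refine ⟨g, ⟨?_, ?_⟩, ?_, ?_⟩
  · ext v
    constructor
    · rintro ⟨w, hw, rfl⟩
      exact (h₁ ⟨w, hw⟩).symm ▸ (g₁ ⟨w, hw⟩).2
    · intro hv
      exact ⟨g₁.symm ⟨v, hv⟩, (g₁.symm ⟨v, hv⟩).2, (h₁ _).trans (by simp)⟩
  · ext v
    constructor
    · rintro ⟨w, hw, rfl⟩
      exact (h₂ ⟨w, hw⟩).symm ▸ (g₂ ⟨w, hw⟩).2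
    · intro hv
      exact ⟨g₂.symm ⟨v, hv⟩, (g₂.symm ⟨v, hv⟩).2, (h₂ _).trans (by simp)⟩
  · intro i
    rw [h₁]
    simp [g₁]
  · intro j
    rw [h₂]
    simp [g₂]

theorem image_repLattice (h : IsCompl W₁ W₂) (ϖ : O) {e e' : Module.Basis (Fin n₁) F W₁}
    {f f' : Module.Basis (Fin n₂) F W₂} {g : V ≃ₗ[F] V} (he : ∀ i, g (e i) = e' i)
    (hf : ∀ j, g (f j) = f' j) (α : DecSeq (min n₁ n₂)) :
    Lattice.image g (repLattice h ϖ e f α) = repLattice h ϖ e' f' α := by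
  refine Subtype.ext ?_
  change Submodule.map _ (Submodule.span O _) = Submodule.span O _
  rw [Submodule.map_span, Set.image_union, ← Set.range_comp, ← Set.range_comp]
  congr 3
  · ext i
    exact he i
  · ext j
    change g (repVec ϖ e f α j) = repVec ϖ e' f' α j
    unfold repVec
    split_ifs
    · rw [map_add, map_smul, he, hf]
    · exact hf j

theorem isLattice_map_projectionOnto (h : IsCompl W₁ W₂) (Λ : Lattice O F V) :
    Submodule.IsLattice F (Λ.1.map ((W₁.projectionOnto W₂ h).restrictScalars O)) where
  fg := Λ.2.fg.map _
  span_eq_top := by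
    rw [Submodule.map_coe, LinearMap.coe_restrictScalars, ← Submodule.map_span,
      Λ.2.span_eq_top, Submodule.map_top, LinearMap.range_eq_top]
    exact Submodule.projectionOnto_surjective h

variable [IsDomain O] [IsDiscreteValuationRing O] [IsFractionRing O F]

theorem isLattice_comap_subtype (W : Submodule F V) (Λ : Lattice O F V) :
    Submodule.IsLattice F (Λ.1.comap (W.subtype.restrictScalars O)) where
  fg := by
    refine Submodule.fg_of_fg_map_injective (W.subtype.restrictScalars O) W.subtype_injective ?_
    exact Submodule.FG.of_le Λ.2.fg (Submodule.map_comap_le _ _)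
  span_eq_top := by
    obtain ⟨ϖ, hϖ⟩ := IsDiscreteValuationRing.exists_irreducible O
    have h0 := algebraMap_uniformizer_ne_zero F hϖ
    rw [eq_top_iff]
    intro w _
    obtain ⟨k, hk⟩ := exists_pow_smul_mem hϖ Λ.2.span_eq_top (w : V)
    have : w = (algebraMap O F ϖ ^ k)⁻¹ • (ϖ ^ k • w) := by
      rw [← algebraMap_smul F (ϖ ^ k) w, map_pow, inv_smul_smul₀ (pow_ne_zero _ h0)]
    rw [this]
    exact Submodule.smul_mem _ _ (Submodule.subset_span hk)

/-- With `M = Λ ∩ W₁` and `P` the projection of `Λ` to `W₂`, the lattice is `M` plus the graph of a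
linear map `σ : P → W₁`. Only `σ` modulo `M` matters, and Smith normal form makes it diagonal. -/
theorem exists_repLattice_eq (h : IsCompl W₁ W₂) {ϖ : O} (hϖ : Irreducible ϖ)
    (e : Module.Basis (Fin n₁) F W₁) (f : Module.Basis (Fin n₂) F W₂) (Λ : Lattice O F V) :
    ∃ (e' : Module.Basis (Fin n₁) F W₁) (f' : Module.Basis (Fin n₂) F W₂)
      (α : DecSeq (min n₁ n₂)), repLattice h ϖ e' f' α = Λ := by
  have h0 := algebraMap_uniformizer_ne_zero F hϖ
  set M := Λ.1.comap (W₁.subtype.restrictScalars O) with hM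
  set P := Λ.1.map ((W₂.projectionOnto W₁ h.symm).restrictScalars O) with hP
  have : Submodule.IsLattice F M := isLattice_comap_subtype W₁ Λ
  have : Submodule.IsLattice F P := isLattice_map_projectionOnto h.symm Λ
  have : Module.IsTorsionFree O F := inferInstance
  have : Module.Free O M := Submodule.IsLattice.free F M
  have : Module.Free O P := Submodule.IsLattice.free F P
  have hM₁ : Module.finrank O M = n₁ := by
    refine Module.finrank_eq_of_rank_eq ?_
    rw [Submodule.IsLattice.rank' F M, rank_eq_card_basis e, Fintype.card_fin]
  have hP₂ : Module.finrank O P = n₂ := by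
    refine Module.finrank_eq_of_rank_eq ?_
    rw [Submodule.IsLattice.rank' F P, rank_eq_card_basis f, Fintype.card_fin]
  -- `P` is free, so the projection from `Λ` onto it splits.
  obtain ⟨s, hs⟩ := Module.projective_lifting_property
    (((W₂.projectionOnto W₁ h.symm).restrictScalars O).submoduleMap Λ.1) LinearMap.id
    (LinearMap.submoduleMap_surjective _ _)
  have hs' : ∀ y : P, W₂.projectionOnto W₁ h.symm (s y) = y := fun y =>
    congrArg Subtype.val (LinearMap.congr_fun hs y)
  let σ : P →ₗ[O] W₁ := (W₁.projectionOnto W₂ h).restrictScalars O ∘ₗ Λ.1.subtype ∘ₗ s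
  have hσ : ∀ y : P, (s y : V) = σ y + (y : W₂) := by
    intro y
    rw [← hs' y]
    exact (projection_add_projection_symm h (s y : V)).symm
  -- Clearing denominators makes `σ` a map between the free modules `P` and `M`, to which Smith
  -- normal form applies.
  obtain ⟨N, hN⟩ := exists_forall_pow_smul_mem hϖ (Submodule.IsLattice.span_eq_top (M := M))
    (Module.Finite.fg_top (R := O) (M := P)) σ
  obtain ⟨r, c, bP, bM, hr, hc, hφ, hφ'⟩ := exists_ordered_smith_bases hϖ hM₁ hP₂
    ((ϖ ^ N • σ).codRestrict M fun y => hN y Submodule.mem_top)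
  have hσ₁ : ∀ (k : Fin r) (hk₁ : k.1 < n₁) (hk₂ : k.1 < n₂),
      ϖ ^ N • σ (bP ⟨k.1, hk₂⟩) = ϖ ^ c k • (bM ⟨k.1, hk₁⟩ : W₁) := fun k hk₁ hk₂ =>
    congrArg Subtype.val (hφ k hk₁ hk₂)
  have hσ₂ : ∀ l : Fin n₂, r ≤ l.1 → σ (bP l) = 0 := by
    intro l hl
    have : ϖ ^ N • σ (bP l) = 0 := congrArg Subtype.val (hφ' l hl)
    rw [← algebraMap_smul F, map_pow] at this
    exact (smul_eq_zero.1 this).resolve_left (pow_ne_zero _ h0)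
  let e' := bM.extendOfIsLattice F
  let f' := bP.extendOfIsLattice F
  have he' : ∀ i, e' i = bM i := fun i => bM.extendOfIsLattice_apply F i
  have hf' : ∀ j, f' j = bP j := fun j => bP.extendOfIsLattice_apply F j
  -- For `j < r`, `σ` sends the `j`-th basis vector to `ϖ ^ (c_j - N) e'_j`. Truncated subtraction
  -- is intended: for `c_j ≥ N` this value lies in `M`, and the exponent is `0`. As `c` increases,
  -- `α` decreases.
  let α : DecSeq (min n₁ n₂) := ⟨fun j => if hj : j.1 < r then N - c ⟨j.1, hj⟩ else 0, by
    intro i j hij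
    by_cases hj : j.1 < r
    · have hi : i.1 < r := lt_of_le_of_lt hij hj
      simp only [hi, hj, dif_pos]
      exact Nat.sub_le_sub_left (hc hij) N
    · simp [hj]⟩
  refine ⟨e', f', α, Subtype.ext ?_⟩
  have heΛ : ∀ i, (e' i : V) ∈ Λ.1 := fun i => he' i ▸ (bM i).2
  set D : Submodule O V := Submodule.span O (Set.range fun i => (e' i : V)) with hD
  have heD : ∀ i, (e' i : V) ∈ D := fun i => Submodule.subset_span ⟨i, rfl⟩
  have hDΛ : D ≤ Λ.1 := Submodule.span_le.2 (by rintro _ ⟨i, rfl⟩; exact heΛ i)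
  have hDα : D ≤ (repLattice h ϖ e' f' α).1 := Submodule.span_mono Set.subset_union_left
  -- Modulo `D`, which is `Λ ∩ W₁`, the generators of `Λ^α` are the lifts of the basis of `P`. When
  -- `α_j = 0`, the vector `e'_j` in `repVec` is absorbed by `D`.
  have key : ∀ j, repVec ϖ e' f' α j - s (bP j) ∈ D := by
    intro j
    rw [hσ, ← hf' j]
    unfold repVec
    by_cases hj : j.1 < r
    · have hj₁ : j.1 < n₁ := hj.trans_le hr
      have hσj := hσ₁ ⟨j.1, hj⟩ hj₁ j.2
      rw [dif_pos hj₁, add_sub_add_right_eq_sub]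
      simp only [α, hj, dif_pos]
      rcases le_total (c ⟨j.1, hj⟩) N with hcN | hcN
      · have : σ (bP j) = algebraMap O F ϖ ^ (-((N - c ⟨j.1, hj⟩ : ℕ) : ℤ)) • e' ⟨j.1, hj₁⟩ := by
          rw [he', ← (IsUnit.mk0 _ (pow_ne_zero N h0)).smul_left_cancel, smul_smul, zpow_neg,
            zpow_natCast, ← pow_sub₀ _ h0 (Nat.sub_le _ _), Nat.sub_sub_self hcN, ← map_pow,
            ← map_pow, algebraMap_smul, algebraMap_smul]
          exact hσj
        rw [this, Submodule.coe_smul, sub_self]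
        exact D.zero_mem
      · have : σ (bP j) = ϖ ^ (c ⟨j.1, hj⟩ - N) • e' ⟨j.1, hj₁⟩ := by
          rw [he', ← (IsUnit.mk0 _ (pow_ne_zero N h0)).smul_left_cancel, ← map_pow,
            algebraMap_smul, algebraMap_smul, smul_smul, ← pow_add, Nat.add_sub_cancel' hcN]
          exact hσj
        rw [this, Nat.sub_eq_zero_of_le hcN, Nat.cast_zero, neg_zero, zpow_zero, one_smul]
        exact D.sub_mem (heD _) (D.smul_mem _ (heD _))
    · rw [hσ₂ j (not_lt.1 hj)]
      split_ifs with hj₁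
      · simp only [α, hj, dif_neg, not_false_eq_true]
        simpa using heD ⟨j.1, hj₁⟩
      · simp
  apply le_antisymm
  · refine Submodule.span_le.2 (Set.union_subset ?_ ?_)
    · rintro _ ⟨i, rfl⟩
      exact heΛ i
    · rintro _ ⟨j, rfl⟩
      simpa using Λ.1.add_mem (hDΛ (key j)) (s (bP j)).2
  · intro v hv
    have hsα : ∀ j, (s (bP j) : V) ∈ (repLattice h ϖ e' f' α).1 := fun j => by
      simpa using Submodule.sub_mem _ (repVec_mem_repLattice h ϖ e' f' α j) (hDα (key j))
    let y : P := ⟨W₂.projectionOnto W₁ h.symm v, v, hv, rfl⟩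
    have hsy : (s y : V) ∈ (repLattice h ϖ e' f' α).1 := by
      rw [← bP.sum_repr y, map_sum, AddSubmonoidClass.coe_finsetSum]
      refine Submodule.sum_mem _ fun j _ => ?_
      rw [map_smul]
      exact Submodule.smul_mem _ _ (hsα j)
    have hW : v - s y ∈ W₁ := by
      rw [← Submodule.projectionOnto_apply_eq_zero_iff h.symm, map_sub, hs', sub_self]
    have hvD : v - s y ∈ D := by
      have hm : (⟨v - s y, hW⟩ : W₁) ∈ M := Λ.1.sub_mem hv (s y).2
      have := congrArg (fun m : M => ((m : W₁) : V)) (bM.sum_repr ⟨_, hm⟩)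
      rw [← show _ = v - s y from this]
      simp only [AddSubmonoidClass.coe_finsetSum]
      refine D.sum_mem fun i _ => ?_
      exact D.smul_mem _ (he' i ▸ heD i)
    simpa using Submodule.add_mem _ (hDα hvD) hsy

theorem exists_mem_repOrbit (h : IsCompl W₁ W₂) {ϖ : O} (hϖ : Irreducible ϖ)
    (e : Module.Basis (Fin n₁) F W₁) (f : Module.Basis (Fin n₂) F W₂) (x : Vertex O F V) :
    ∃ α, x ∈ repOrbit h ϖ e f α := by
  obtain ⟨Λ, rfl⟩ := x.exists_mk_eq
  obtain ⟨e', f', α, rfl⟩ := exists_repLattice_eq h hϖ e f Λ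
  obtain ⟨g, hg, he, hf⟩ := exists_levi_of_bases h e e' f f'
  exact ⟨α, mk_mem_leviOrbit_mk_iff.2 ⟨g, hg, image_repLattice h ϖ he hf α⟩⟩

theorem range_repOrbit (h : IsCompl W₁ W₂) {ϖ : O} (hϖ : Irreducible ϖ)
    (e : Module.Basis (Fin n₁) F W₁) (f : Module.Basis (Fin n₂) F W₂) :
    Set.range (repOrbit (O := O) h ϖ e f) = Set.range (leviOrbit (O := O) W₁ W₂) := by
  apply Set.Subset.antisymm
  · rintro _ ⟨α, rfl⟩
    exact ⟨_, rfl⟩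
  · rintro _ ⟨x, rfl⟩
    obtain ⟨α, hα⟩ := exists_mem_repOrbit h hϖ e f x
    exact ⟨α, (leviOrbit_eq_iff.2 hα).symm⟩

end OrbitRepresentatives

end EuclideanBuilding

namespace EuclideanBuilding

/-! ### Adapted apartments and the orbit of the zero sequence. -/

section Apartments

variable {O F V : Type*} [CommRing O] [Field F] [Algebra O F] [AddCommGroup V] [Module F V]
  {W₁ W₂ : Submodule F V} {n₁ n₂ : ℕ}

theorem isFrame_of_basis {W : Submodule F V} {n : ℕ} (e : Module.Basis (Fin n) F W) :
    IsFrame W (Set.range fun i => Submodule.span F {(e i : V)}) where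
  line := by
    rintro _ ⟨i, rfl⟩
    exact finrank_span_singleton fun h => e.ne_zero i (Subtype.ext h)
  indep := by
    refine iSupIndep.sSupIndep_range (LinearIndependent.iSupIndep_span_singleton ?_)
    exact e.linearIndependent.map' W.subtype W.ker_subtype
  span := by
    rw [sSup_range, ← Submodule.span_range_eq_iSup]
    have : (Set.range fun i => (e i : V)) = W.subtype '' Set.range e := by
      rw [← Set.range_comp]
      rfl
    rw [this, ← Submodule.map_span, e.span_eq, Submodule.map_top, Submodule.range_subtype]

theorem isFrame_iff_of_finrank_eq_one {W : Submodule F V} (hW : Module.finrank F W = 1)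
    {S : Set (Submodule F V)} : IsFrame W S ↔ S = {W} := by
  constructor
  · intro hS
    have : FiniteDimensional F W := Module.finite_of_finrank_eq_succ hW
    have hsub : S ⊆ {W} := fun l hl => Submodule.eq_of_le_of_finrank_eq
      (hS.span ▸ le_sSup hl) ((hS.line l hl).trans hW.symm)
    refine (Set.subset_singleton_iff_eq.1 hsub).resolve_left fun h => ?_
    have := hS.span
    rw [h, sSup_empty] at this
    rw [← this, finrank_bot] at hW
    exact zero_ne_one hW
  · rintro rfl
    exact ⟨fun l hl => (Set.mem_singleton_iff.1 hl) ▸ hW, sSupIndep_singleton W, sSup_singleton⟩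

variable [Module O V]

theorem span_range_union_repVec_zero (ϖ : O) (e : Module.Basis (Fin n₁) F W₁)
    (f : Module.Basis (Fin n₂) F W₂) :
    Submodule.span O ((Set.range fun i => (e i : V)) ∪
      Set.range (repVec ϖ e f (DecSeq.zero (min n₁ n₂)))) =
    Submodule.span O ((Set.range fun i => (e i : V)) ∪ Set.range fun j => (f j : V)) := by
  apply le_antisymm
  · refine Submodule.span_le.2 (Set.union_subset ?_ ?_)
    · exact Set.subset_union_left.trans Submodule.subset_span
    · rintro _ ⟨j, rfl⟩
      unfold repVec
      have hf : (f j : V) ∈ Submodule.span O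
          ((Set.range fun i => (e i : V)) ∪ Set.range fun j => (f j : V)) :=
        Submodule.subset_span (Or.inr ⟨j, rfl⟩)
      split_ifs with hj
      · refine Submodule.add_mem _ ?_ hf
        have he : (e ⟨j.1, hj⟩ : V) ∈ Submodule.span O
            ((Set.range fun i => (e i : V)) ∪ Set.range fun j => (f j : V)) :=
          Submodule.subset_span (Or.inl ⟨⟨j.1, hj⟩, rfl⟩)
        simpa [DecSeq.zero] using he
      · exact hf
  · refine Submodule.span_le.2 (Set.union_subset ?_ ?_)
    · exact Set.subset_union_left.trans Submodule.subset_span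
    · rintro _ ⟨j, rfl⟩
      have hj : repVec ϖ e f (DecSeq.zero (min n₁ n₂)) j ∈ Submodule.span O
          ((Set.range fun i => (e i : V)) ∪ Set.range (repVec ϖ e f (DecSeq.zero (min n₁ n₂)))) :=
        Submodule.subset_span (Or.inr ⟨j, rfl⟩)
      by_cases hj' : j.1 < n₁
      · have he : (e ⟨j.1, hj'⟩ : V) ∈ Submodule.span O ((Set.range fun i => (e i : V)) ∪
            Set.range (repVec ϖ e f (DecSeq.zero (min n₁ n₂)))) :=
          Submodule.subset_span (Or.inl ⟨⟨j.1, hj'⟩, rfl⟩)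
        have : repVec ϖ e f (DecSeq.zero (min n₁ n₂)) j = e ⟨j.1, hj'⟩ + f j := by
          simp [repVec, hj', DecSeq.zero]
        rw [this] at hj
        exact (Submodule.add_mem_iff_right _ he).1 hj
      · have : repVec ϖ e f (DecSeq.zero (min n₁ n₂)) j = f j := by
          simp [repVec, hj']
        rwa [this] at hj

variable [IsScalarTower O F V]

theorem adaptedApartments_of_finrank_eq_one (h₁ : Module.finrank F W₁ = 1)
    (h₂ : Module.finrank F W₂ = 1) : adaptedApartments O W₁ W₂ = apartment O {W₁, W₂} := by
  ext x
  constructor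
  · rintro ⟨S₁, S₂, hS₁, hS₂, hx⟩
    rw [isFrame_iff_of_finrank_eq_one h₁] at hS₁
    rw [isFrame_iff_of_finrank_eq_one h₂] at hS₂
    rwa [hS₁, hS₂, Set.singleton_union] at hx
  · intro hx
    refine ⟨{W₁}, {W₂}, (isFrame_iff_of_finrank_eq_one h₁).2 rfl,
      (isFrame_iff_of_finrank_eq_one h₂).2 rfl, ?_⟩
    rwa [Set.singleton_union]

/-- An apartment is indexed by lines and not by basis vectors. Independent vectors span distinct
lines, so the vector chosen for a line is the original one. -/
theorem mk_mem_adaptedApartments_of_bases (h : IsCompl W₁ W₂) (e : Module.Basis (Fin n₁) F W₁)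
    (f : Module.Basis (Fin n₂) F W₂) {Λ : Lattice O F V}
    (hΛ : Λ.1 = Submodule.span O ((Set.range fun i => (e i : V)) ∪ Set.range fun j => (f j : V))) :
    Vertex.mk Λ ∈ adaptedApartments O W₁ W₂ := by
  let w : Fin n₁ ⊕ Fin n₂ → V := Sum.elim (fun i => (e i : V)) fun j => (f j : V)
  have hli : LinearIndependent F w := by
    refine LinearIndependent.sum_type (e.linearIndependent.map' W₁.subtype W₁.ker_subtype)
      (f.linearIndependent.map' W₂.subtype W₂.ker_subtype) (h.disjoint.mono ?_ ?_)
    · exact Submodule.span_le.2 (by rintro _ ⟨i, rfl⟩; exact (e i).2)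
    · exact Submodule.span_le.2 (by rintro _ ⟨i, rfl⟩; exact (f i).2)
  have hinj : Function.Injective fun i => Submodule.span F {w i} :=
    hli.iSupIndep_span_singleton.injective fun i => by
      rw [Ne, Submodule.span_singleton_eq_bot]
      exact hli.ne_zero i
  let S₁ : Set (Submodule F V) := Set.range fun i => Submodule.span F {(e i : V)}
  let S₂ : Set (Submodule F V) := Set.range fun j => Submodule.span F {(f j : V)}
  have hS : ∀ l : ↥(S₁ ∪ S₂), ∃ i, Submodule.span F {w i} = l := by
    rintro ⟨_, ⟨i, rfl⟩ | ⟨j, rfl⟩⟩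
    · exact ⟨Sum.inl i, rfl⟩
    · exact ⟨Sum.inr j, rfl⟩
  choose k hk using hS
  refine ⟨S₁, S₂, isFrame_of_basis e, isFrame_of_basis f, Λ, fun l => w (k l), fun l => ⟨?_, ?_⟩,
    ?_, rfl⟩
  · rw [← hk l]
    exact Submodule.mem_span_singleton_self _
  · exact hli.ne_zero _
  · rw [hΛ, ← Set.Sum.elim_range]
    congr 1
    apply Set.Subset.antisymm
    · rintro _ ⟨i, rfl⟩
      have hi : Submodule.span F {w i} ∈ S₁ ∪ S₂ := by
        rcases i with i | j
        · exact Or.inl ⟨i, rfl⟩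
        · exact Or.inr ⟨j, rfl⟩
      exact ⟨⟨_, hi⟩, congrArg w (hinj (hk ⟨_, hi⟩))⟩
    · rintro _ ⟨l, rfl⟩
      exact ⟨k l, rfl⟩

theorem DecSeq.eq_zero_of_sup_eq_zero {n : ℕ} {α : DecSeq n} (hα : Finset.univ.sup α.1 = 0) :
    α = DecSeq.zero n :=
  Subtype.ext (funext fun i => Nat.le_zero.1 (hα ▸ Finset.le_sup (Finset.mem_univ i)))

variable [IsDomain O] [IsDiscreteValuationRing O] [IsFractionRing O F]

/-- Each generator lies in `W₁` or in `W₂`, so the projection fixes it or kills it and maps the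
lattice to itself. -/
theorem annLog_eq_zero_of_mem_adaptedApartments (h : IsCompl W₁ W₂) {x : Vertex O F V}
    (hx : x ∈ adaptedApartments O W₁ W₂) : annLog h x = 0 := by
  obtain ⟨ϖ, hϖ⟩ := IsDiscreteValuationRing.exists_irreducible O
  obtain ⟨S₁, S₂, hS₁, hS₂, Λ, b, hb, hΛ, rfl⟩ := hx
  rw [← Nat.le_zero, annLog_le_iff hϖ]
  intro v hv
  rw [pow_zero, one_smul]
  rw [hΛ] at hv ⊢
  induction hv using Submodule.span_induction with
  | mem x hx =>
    obtain ⟨l, rfl⟩ := hx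
    rcases l.2 with hl | hl
    · have : b l ∈ W₁ := hS₁.span ▸ (le_sSup hl : l.1 ≤ _) (hb l).1
      rw [Submodule.projection_apply_of_mem_left h this]
      exact Submodule.subset_span ⟨l, rfl⟩
    · have : b l ∈ W₂ := hS₂.span ▸ (le_sSup hl : l.1 ≤ _) (hb l).1
      rw [Submodule.projection_apply_of_mem_right h this]
      exact Submodule.zero_mem _
  | zero => simp
  | add x y _ _ hx hy =>
    rw [map_add]
    exact Submodule.add_mem _ hx hy
  | smul a x _ hx =>
    rw [smul_projection]
    exact Submodule.smul_mem _ _ hx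

theorem mem_adaptedApartments_iff (h : IsCompl W₁ W₂) (e : Module.Basis (Fin n₁) F W₁)
    (f : Module.Basis (Fin n₂) F W₂) {x : Vertex O F V} :
    x ∈ adaptedApartments O W₁ W₂ ↔ annLog h x = 0 := by
  refine ⟨annLog_eq_zero_of_mem_adaptedApartments h, fun hx => ?_⟩
  obtain ⟨ϖ, hϖ⟩ := IsDiscreteValuationRing.exists_irreducible O
  obtain ⟨Λ, rfl⟩ := x.exists_mk_eq
  obtain ⟨e', f', α, rfl⟩ := exists_repLattice_eq h hϖ e f Λ
  rw [annLog_repLattice h hϖ] at hx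
  rw [DecSeq.eq_zero_of_sup_eq_zero hx]
  exact mk_mem_adaptedApartments_of_bases h e' f' (span_range_union_repVec_zero ϖ e' f')

theorem annLog_eq_sup_of_mem_repOrbit (h : IsCompl W₁ W₂) {ϖ : O} (hϖ : Irreducible ϖ)
    {e : Module.Basis (Fin n₁) F W₁} {f : Module.Basis (Fin n₂) F W₂} {α : DecSeq (min n₁ n₂)}
    {x : Vertex O F V} (hx : x ∈ repOrbit h ϖ e f α) : annLog h x = Finset.univ.sup α.1 := by
  rw [annLog_eq_of_mem_leviOrbit h hx, annLog_repLattice h hϖ]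

theorem adaptedApartments_eq_repOrbit_zero (h : IsCompl W₁ W₂) {ϖ : O} (hϖ : Irreducible ϖ)
    (e : Module.Basis (Fin n₁) F W₁) (f : Module.Basis (Fin n₂) F W₂) :
    adaptedApartments O W₁ W₂ = repOrbit h ϖ e f (DecSeq.zero (min n₁ n₂)) := by
  ext x
  rw [mem_adaptedApartments_iff h e f]
  constructor
  · intro hx
    obtain ⟨α, hα⟩ := exists_mem_repOrbit h hϖ e f x
    rw [annLog_eq_sup_of_mem_repOrbit h hϖ hα] at hx
    rwa [DecSeq.eq_zero_of_sup_eq_zero hx] at hα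
  · intro hx
    rw [annLog_eq_sup_of_mem_repOrbit h hϖ hx]
    exact Nat.le_zero.1 (Finset.sup_le fun i _ => le_rfl)

theorem annLog_eq_orbitalDist (h : IsCompl W₁ W₂) {ϖ : O} (hϖ : Irreducible ϖ)
    (e : Module.Basis (Fin n₁) F W₁) (f : Module.Basis (Fin n₂) F W₂) (x : Vertex O F V) :
    annLog h x = orbitalDist h ϖ e f (leviOrbit W₁ W₂ x) (adaptedApartments O W₁ W₂) := by
  obtain ⟨α, hα⟩ := exists_mem_repOrbit h hϖ e f x
  -- Both orbits are values of the injective map `repOrbit`, so `invFun` returns their true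
  -- sequences and no default value occurs.
  have hinv := Function.leftInverse_invFun (repOrbit_injective h hϖ e f)
  have hx : leviOrbit W₁ W₂ x = repOrbit h ϖ e f α := leviOrbit_eq_iff.2 hα
  rw [annLog_eq_sup_of_mem_repOrbit h hϖ hα, orbitalDist, hx,
    adaptedApartments_eq_repOrbit_zero h hϖ e f, hinv, hinv]
  simp [DecSeq.dist, DecSeq.zero]

end Apartments

/-! ### Distances in the `1`-skeleton. -/

section Distance

variable {O F V : Type*} [CommRing O] [IsDomain O] [IsDiscreteValuationRing O] [Field F]
  [Algebra O F] [IsFractionRing O F] [AddCommGroup V] [Module F V]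
  [Module O V] [IsScalarTower O F V] {W₁ W₂ : Submodule F V} {n₁ n₂ : ℕ}

theorem annLog_le_add_one_of_incident (h : IsCompl W₁ W₂) {ϖ : O} (hϖ : Irreducible ϖ)
    {x y : Vertex O F V} (hxy : Incident ϖ x y) :
    annLog h x ≤ annLog h y + 1 ∧ annLog h y ≤ annLog h x + 1 := by
  obtain ⟨Λ₁, Λ₂, rfl, rfl, h₁, h₂⟩ := hxy
  have h₁' : ∀ v ∈ Λ₁.1, ϖ • v ∈ Λ₂.1 := fun v hv =>
    h₁ (Submodule.smul_mem_pointwise_smul v ϖ _ hv)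
  constructor
  · rw [annLog_le_iff hϖ]
    intro v hv
    have := (annLog_le_iff hϖ h Λ₂ _).1 le_rfl _ (h₁' v hv)
    rw [smul_projection, smul_smul, ← pow_succ] at this
    exact h₂ this
  · rw [annLog_le_iff hϖ]
    intro v hv
    have := h₁' _ ((annLog_le_iff hϖ h Λ₁ _).1 le_rfl _ (h₂ hv))
    rwa [smul_smul, ← pow_succ'] at this

/-- The exponent changes by at most one per edge, so it is `1`-Lipschitz along walks; without a walk
the distance is `⊤`. -/
theorem annLog_le_add_edist (h : IsCompl W₁ W₂) {ϖ : O} (hϖ : Irreducible ϖ)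
    (x y : Vertex O F V) :
    (annLog h x : ℕ∞) ≤ annLog h y + (oneSkeleton F V ϖ).edist x y := by
  have key : ∀ {x y : Vertex O F V} (p : (oneSkeleton F V ϖ).Walk x y),
      annLog h x ≤ annLog h y + p.length := by
    intro x y p
    induction p with
    | nil => simp
    | cons hadj p ih =>
      rw [SimpleGraph.Walk.length_cons]
      rcases ((SimpleGraph.fromRel_adj _ _ _).1 hadj).2 with H | H
      · have := (annLog_le_add_one_of_incident h hϖ H).1
        omega
      · have := (annLog_le_add_one_of_incident h hϖ H).2
        omega
  rcases isEmpty_or_nonempty ((oneSkeleton F V ϖ).Walk x y) with hE | hN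
  · rw [SimpleGraph.edist, iInf_of_empty, add_top]
    exact le_top
  · rw [SimpleGraph.edist, ENat.add_iInf]
    refine le_iInf fun p => ?_
    exact_mod_cast key p

/-- The lattice `(Λ ∩ W) + ϖ ^ k Λ`. -/
noncomputable def towardsApartment (W : Submodule F V) {ϖ : O} (hϖ : Irreducible ϖ)
    (Λ : Lattice O F V) (k : ℕ) : Lattice O F V :=
  ⟨kerPart W Λ ⊔ ϖ ^ k • Λ.1,
    { fg := by
        refine Submodule.FG.of_le Λ.2.fg (sup_le inf_le_left ?_)
        rintro _ ⟨v, hv, rfl⟩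
        exact Λ.1.smul_mem _ hv
      span_eq_top := by
        rw [← top_le_iff, ← Λ.2.span_eq_top, Submodule.span_le]
        intro v hv
        have h0 := algebraMap_uniformizer_ne_zero F hϖ
        have : v = (algebraMap O F ϖ ^ k)⁻¹ • (ϖ ^ k • v) := by
          rw [← algebraMap_smul F (ϖ ^ k) v, map_pow, inv_smul_smul₀ (pow_ne_zero _ h0)]
        rw [this]
        exact Submodule.smul_mem _ _ (Submodule.subset_span
          (Submodule.mem_sup_right (Submodule.smul_mem_pointwise_smul v _ _ hv))) }⟩

theorem mem_towardsApartment {W : Submodule F V} {ϖ : O} (hϖ : Irreducible ϖ)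
    {Λ : Lattice O F V} {k : ℕ} {v : V} :
    v ∈ (towardsApartment W hϖ Λ k).1 ↔
      ∃ m ∈ Λ.1, m ∈ W ∧ ∃ u ∈ Λ.1, m + ϖ ^ k • u = v := by
  change v ∈ kerPart W Λ ⊔ ϖ ^ k • Λ.1 ↔ _
  rw [Submodule.mem_sup]
  constructor
  · rintro ⟨m, hm, _, ⟨u, hu, rfl⟩, rfl⟩
    exact ⟨m, hm.1, hm.2, u, hu, rfl⟩
  · rintro ⟨m, hm, hmW, u, hu, rfl⟩
    exact ⟨m, ⟨hm, hmW⟩, _, ⟨u, hu, rfl⟩, rfl⟩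

theorem towardsApartment_zero (W : Submodule F V) {ϖ : O} (hϖ : Irreducible ϖ)
    (Λ : Lattice O F V) : towardsApartment W hϖ Λ 0 = Λ := by
  refine Subtype.ext (Submodule.ext fun v => ?_)
  rw [mem_towardsApartment]
  constructor
  · rintro ⟨m, hm, -, u, hu, rfl⟩
    exact Λ.1.add_mem hm (Λ.1.smul_mem _ hu)
  · intro hv
    exact ⟨0, Λ.1.zero_mem, W.zero_mem, v, hv, by simp⟩

theorem incident_towardsApartment (W : Submodule F V) {ϖ : O} (hϖ : Irreducible ϖ)
    (Λ : Lattice O F V) (k : ℕ) :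
    Incident ϖ (Vertex.mk (towardsApartment W hϖ Λ k))
      (Vertex.mk (towardsApartment W hϖ Λ (k + 1))) := by
  refine ⟨_, _, rfl, rfl, ?_, ?_⟩
  · rintro _ ⟨v, hv, rfl⟩
    obtain ⟨m, hm, hmW, u, hu, rfl⟩ := (mem_towardsApartment hϖ).1 hv
    refine (mem_towardsApartment hϖ).2 ⟨ϖ • m, Λ.1.smul_mem _ hm,
      (W.restrictScalars O).smul_mem _ hmW, u, hu, ?_⟩
    rw [pow_succ', mul_smul]
    exact (smul_add _ _ _).symm
  · intro v hv
    obtain ⟨m, hm, hmW, u, hu, rfl⟩ := (mem_towardsApartment hϖ).1 hv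
    exact (mem_towardsApartment hϖ).2 ⟨m, hm, hmW, ϖ • u, Λ.1.smul_mem _ hu, by
      rw [smul_smul, ← pow_succ]⟩

theorem edist_towardsApartment_le (W : Submodule F V) {ϖ : O} (hϖ : Irreducible ϖ)
    (Λ : Lattice O F V) (k : ℕ) :
    (oneSkeleton F V ϖ).edist (Vertex.mk Λ) (Vertex.mk (towardsApartment W hϖ Λ k)) ≤ k := by
  induction k with
  | zero => rw [towardsApartment_zero, SimpleGraph.edist_self]; exact zero_le
  | succ k ih =>
    refine (SimpleGraph.edist_triangle (v := Vertex.mk (towardsApartment W hϖ Λ k))).trans ?_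
    rw [Nat.cast_succ]
    refine add_le_add ih ?_
    -- Consecutive classes may coincide, for instance for `W = ⊥`, and then there is no edge.
    by_cases hne : Vertex.mk (towardsApartment W hϖ Λ k) =
        Vertex.mk (towardsApartment W hϖ Λ (k + 1))
    · rw [hne, SimpleGraph.edist_self]
      exact zero_le
    · exact (SimpleGraph.edist_eq_one_iff_adj.2 ((SimpleGraph.fromRel_adj _ _ _).2
        ⟨hne, Or.inl (incident_towardsApartment W hϖ Λ k)⟩)).le

/-- For `d = d_A([Λ])` the projection sends `m + ϖ ^ d u` to `m + ϖ ^ d p(u)`, which lies in `Λ ∩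
W₁` by the criterion for `Λ`. So the new lattice is stable under the projection. -/
theorem annLog_towardsApartment (h : IsCompl W₁ W₂) {ϖ : O} (hϖ : Irreducible ϖ)
    (Λ : Lattice O F V) :
    annLog h (Vertex.mk (towardsApartment W₁ hϖ Λ (annLog h (Vertex.mk Λ)))) = 0 := by
  rw [← Nat.le_zero, annLog_le_iff hϖ]
  intro v hv
  obtain ⟨m, hm, hmW, u, hu, rfl⟩ := (mem_towardsApartment hϖ).1 hv
  rw [pow_zero, one_smul, map_add, Submodule.projection_apply_of_mem_left h hmW, smul_projection]
  exact (mem_towardsApartment hϖ).2 ⟨_,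
    Λ.1.add_mem hm ((annLog_le_iff hϖ h Λ _).1 le_rfl u hu),
    W₁.add_mem hmW ((W₁.restrictScalars O).smul_mem _ (Submodule.projection_apply_mem h u)),
    0, Λ.1.zero_mem, by simp⟩

theorem annLog_eq_iInf_edist (h : IsCompl W₁ W₂) {ϖ : O} (hϖ : Irreducible ϖ)
    (e : Module.Basis (Fin n₁) F W₁) (f : Module.Basis (Fin n₂) F W₂) (x : Vertex O F V) :
    (annLog h x : ℕ∞) = ⨅ z ∈ adaptedApartments O W₁ W₂, (oneSkeleton F V ϖ).edist x z := by
  apply le_antisymm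
  · refine le_iInf₂ fun z hz => ?_
    have := annLog_le_add_edist h hϖ x z
    rwa [annLog_eq_zero_of_mem_adaptedApartments h hz, Nat.cast_zero, zero_add] at this
  · obtain ⟨Λ, rfl⟩ := x.exists_mk_eq
    exact iInf₂_le_of_le _ ((mem_adaptedApartments_iff h e f).2 (annLog_towardsApartment h hϖ Λ))
      (edist_towardsApartment_le W₁ hϖ Λ _)

/-- The inner infimum is the exponent of `y`, which is constant on the orbit. -/
theorem annLog_eq_iInf_iInf_edist (h : IsCompl W₁ W₂) {ϖ : O} (hϖ : Irreducible ϖ)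
    (e : Module.Basis (Fin n₁) F W₁) (f : Module.Basis (Fin n₂) F W₂) (x : Vertex O F V) :
    (annLog h x : ℕ∞) = ⨅ y ∈ leviOrbit W₁ W₂ x, ⨅ z ∈ adaptedApartments O W₁ W₂,
      (oneSkeleton F V ϖ).edist y z := by
  apply le_antisymm
  · refine le_iInf₂ fun y hy => ?_
    rw [← annLog_eq_iInf_edist h hϖ e f, annLog_eq_of_mem_leviOrbit h hy]
  · exact iInf₂_le_of_le x (mem_leviOrbit_self x) (annLog_eq_iInf_edist h hϖ e f x).ge

end Distance

end EuclideanBuilding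

open EuclideanBuilding in
theorem mainTheorem4 {O F V : Type*} [CommRing O] [IsDomain O] [IsDiscreteValuationRing O]
    [Field F] [Algebra O F] [IsFractionRing O F]
    [AddCommGroup V] [Module F V] [Module O V] [IsScalarTower O F V]
    (ϖ : O) (hϖ : Irreducible ϖ)
    (W₁ W₂ : Submodule F V) (hW : IsCompl W₁ W₂) (n₁ n₂ : ℕ)
    (e : Module.Basis (Fin n₁) F W₁) (f : Module.Basis (Fin n₂) F W₂) :
    -- the orbits of `L` are identified with `A^n` through `α ↦ L [Λ^α]`
    (Function.Injective (repOrbit (O := O) hW ϖ e f) ∧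
      Set.range (repOrbit (O := O) hW ϖ e f) = Set.range (leviOrbit (O := O) W₁ W₂)) ∧
    -- the union of the adapted apartments is one orbit, the one of the zero sequence
    adaptedApartments O W₁ W₂ = repOrbit hW ϖ e f (DecSeq.zero (min n₁ n₂)) ∧
    -- `Q(Λ)` does not depend on the choice of the summand, and its annihilator is `P ^ d_A([Λ])`
    (∀ Λ : Lattice O F V, Nonempty (QMod hW Λ ≃ₗ[O] QMod hW.symm Λ) ∧
      Module.annihilator O (QMod hW Λ) =
        IsLocalRing.maximalIdeal O ^ annLog hW (Vertex.mk Λ)) ∧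
    -- `d_A([Λ])` is the largest `α_i`
    (∀ (x : Vertex O F V) (α : DecSeq (min n₁ n₂)), leviOrbit W₁ W₂ x = repOrbit hW ϖ e f α →
      annLog hW x = Finset.univ.sup α.1) ∧
    -- `d_A([Λ])` is the orbital distance, and the distance in the `1`-skeleton, from the orbit
    -- of `[Λ]` to the union of the adapted apartments
    (∀ x : Vertex O F V,
      annLog hW x = orbitalDist hW ϖ e f (leviOrbit W₁ W₂ x) (adaptedApartments O W₁ W₂) ∧
      (annLog hW x : ℕ∞) = (⨅ y ∈ leviOrbit W₁ W₂ x, ⨅ z ∈ adaptedApartments O W₁ W₂,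
        (oneSkeleton F V ϖ).edist y z) ∧
      (annLog hW x : ℕ∞) = (⨅ z ∈ adaptedApartments O W₁ W₂, (oneSkeleton F V ϖ).edist x z)) ∧
    -- the torus case: the distance from a vertex to the apartment of the frame `{W₁, W₂}`
    (n₁ = 1 → n₂ = 1 → adaptedApartments O W₁ W₂ = apartment O {W₁, W₂} ∧
      ∀ x : Vertex O F V,
        (annLog hW x : ℕ∞) = ⨅ z ∈ apartment O {W₁, W₂}, (oneSkeleton F V ϖ).edist x z) := by
  refine ⟨⟨repOrbit_injective hW hϖ e f, range_repOrbit hW hϖ e f⟩,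
    adaptedApartments_eq_repOrbit_zero hW hϖ e f,
    fun Λ => ⟨nonempty_QMod_equiv hW Λ, annihilator_QMod hϖ hW Λ⟩,
    fun x α hx => annLog_eq_sup_of_mem_repOrbit hW hϖ (leviOrbit_eq_iff.1 hx),
    fun x => ⟨annLog_eq_orbitalDist hW hϖ e f x, annLog_eq_iInf_iInf_edist hW hϖ e f x,
      annLog_eq_iInf_edist hW hϖ e f x⟩, fun h₁ h₂ => ?_⟩
  have key : adaptedApartments O W₁ W₂ = apartment O {W₁, W₂} :=
    adaptedApartments_of_finrank_eq_one
      (by rw [Module.finrank_eq_card_basis e, h₁, Fintype.card_fin])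
      (by rw [Module.finrank_eq_card_basis f, h₂, Fintype.card_fin])
  exact ⟨key, fun x => key ▸ annLog_eq_iInf_edist hW hϖ e f x⟩
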